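/- Notation. For positive integers $n_1,n_2$ put $n_{(1)}=\max(n_1,n_2)$ and $n_{(2)}=\min(n_1,n_2)$. For a real $n_1\times n_2$ matrix $M$, $\|M\|$ denotes the operator norm (largest singular value) and $\|M\|_\infty=\max_{i,j}|M_{ij}|$; $\mathrm{sgn}(M)$ is the matrix of the signs of the entries, with $\mathrm{sgn}(0)=0$. The space $\mathbb R^{n_1\times n_2}$ carries the Frobenius inner product; for a linear operator $\mathcal A$ on it, $\|\mathcal A\|$ is the operator norm with respect to the Frobenius norm. For $\Omega\subset[n_1]\times[n_2]$, $\mathcal P_\Omega$ is the orthogonal projection onto the space of matrices supported on $\Omega$. Lemma. There are positive numerical constants $\rho_r,\rho_s,c$ such that the following holds for all $n_1,n_2\ge 1$. Let $L_0\in\mathbb R^{n_1\times n_2}$ have rank $r$ and reduced singular value decomposition $L_0=U\Sigma V^*$ with $U\in\mathbb R^{n_1\times r}$, $V\in\mathbb R^{n_2\times r}$, and suppose that for some $\mu>0$ $$\max_i\|U^*e_i\|^2\le\frac{\mu r}{n_1},\qquad \max_j\|V^*e_j\|^2\le\frac{\mu r}{n_2},\qquad \|UV^*\|_\infty\le\sqrt{\frac{\mu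 r}{n_1n_2}},$$ and that $r\,\mu\,(\log n_{(1)})^2\le\rho_r\,n_{(2)}$. Let $0\le\rho\le\rho_s$, and let $S_0$ be a random $n_1\times n_2$ matrix whose support $\Omega=\{(i,j):(S_0)_{ij}\ne0\}$ contains each entry independently with probability $\rho$, and such that the signs of its entries on $\Omega$ are i.i.d. symmetric and independent of $\Omega$ (that is, given $\Omega$ they are uniformly distributed over $\{\pm1\}^{\Omega}$). Let $T=\{UX^*+YV^*: X\in\mathbb R^{n_2\times r},\,Y\in\mathbb R^{n_1\times r}\}$, let $\mathcal P_T$, $\mathcal P_{T^\perp}$ be the orthogonal projections onto $T$ and its orthogonal complement, and let $\lambda=1/\sqrt{n_{(1)}}$. Then with probability at least $1-c\,n_{(1)}^{-10}$: $\|\mathcal P_\Omega\mathcal P_T\|<1/2$; the operator $\mathcal P_\Omega-\mathcal P_\Omega\mathcal P_T\mathcal P_\Omega$ is invertible on the space of matrices supported on $\Omega$, so that $$W^S=\lambda\,\mathcal P_{T^\perp}(\mathcal P_\Omega-\mathcal P_\Omega\mathcal P_T\mathcal P_\Omega)^{-1}\,\mathrm{sgn}(S_0)$$ is well defined; and (a)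 $\|W^S\|<1/4$, (b) $\|\mathcal P_{\Omega^c}W^S\|_\infty<\lambda/4$. -/

import Mathlib

open MeasureTheory ProbabilityTheory

noncomputable section

namespace RobustPCA

/-- Real `n₁ × n₂` matrices as a Euclidean space: the inner product is the trace inner product
`∑ i j, X i j * Y i j`, and the norm is the Frobenius norm. -/
abbrev Frob (n₁ n₂ : ℕ) : Type := EuclideanSpace ℝ (Fin n₁ × Fin n₂)

/-- The matrix `M`, seen as an element of the Frobenius space. -/
def ofMat {n₁ n₂ : ℕ} (M : Matrix (Fin n₁) (Fin n₂) ℝ) : Frob n₁ n₂ :=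
  WithLp.toLp 2 (fun p => M p.1 p.2)

/-- The element `X` of the Frobenius space, seen as a matrix. -/
def toMat {n₁ n₂ : ℕ} (X : Frob n₁ n₂) : Matrix (Fin n₁) (Fin n₂) ℝ :=
  Matrix.of fun i j => X (i, j)

/-- The operator norm (largest singular value) of a matrix: its norm as a map between Euclidean
spaces. -/
def opNorm {n₁ n₂ : ℕ} (M : Matrix (Fin n₁) (Fin n₂) ℝ) : ℝ :=
  ‖LinearMap.toContinuousLinearMap (Matrix.toEuclideanLin M)‖

/-- The `ℓ∞` norm `max_{i,j} |M i j|` of a matrix seen as a long vector. -/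
def maxNorm {n₁ n₂ : ℕ} (M : Matrix (Fin n₁) (Fin n₂) ℝ) : ℝ :=
  ‖fun p : Fin n₁ × Fin n₂ => M p.1 p.2‖

/-- The reduced singular value decomposition `L = U Σ Vᵀ`, with as many (positive) singular values
as the rank of `L`. -/
structure IsSVD {n₁ n₂ : ℕ} (L : Matrix (Fin n₁) (Fin n₂) ℝ)
    (U : Matrix (Fin n₁) (Fin L.rank) ℝ) (s : Fin L.rank → ℝ)
    (V : Matrix (Fin n₂) (Fin L.rank) ℝ) : Prop where
  orthonormal_left : U.transpose * U = 1
  orthonormal_right : V.transpose * V = 1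
  pos : ∀ k, 0 < s k
  eq : L = U * Matrix.diagonal s * V.transpose

/-- Incoherence with parameter `μ` of the matrices `U`, `V` of singular vectors. Here
`∑ k, U i k ^ 2` is `‖Uᵀ eᵢ‖²`. -/
structure Incoherent {n₁ n₂ r : ℕ} (μ : ℝ) (U : Matrix (Fin n₁) (Fin r) ℝ)
    (V : Matrix (Fin n₂) (Fin r) ℝ) : Prop where
  left : ∀ i, ∑ k, U i k ^ 2 ≤ μ * r / n₁
  right : ∀ j, ∑ k, V j k ^ 2 ≤ μ * r / n₂
  joint : maxNorm (U * V.transpose) ≤ Real.sqrt (μ * r / (n₁ * n₂))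

/-- The linear space `T = {U Xᵀ + Y Vᵀ}`. -/
def tangent {n₁ n₂ r : ℕ} (U : Matrix (Fin n₁) (Fin r) ℝ) (V : Matrix (Fin n₂) (Fin r) ℝ) :
    Submodule ℝ (Frob n₁ n₂) where
  carrier := {Z | ∃ (X : Matrix (Fin n₂) (Fin r) ℝ) (Y : Matrix (Fin n₁) (Fin r) ℝ),
    Z = ofMat (U * X.transpose + Y * V.transpose)}
  add_mem' := by
    rintro _ _ ⟨X, Y, rfl⟩ ⟨X', Y', rfl⟩
    refine ⟨X + X', Y + Y', ?_⟩
    ext p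
    simp only [ofMat, PiLp.add_apply, Matrix.transpose_add, Matrix.mul_add, Matrix.add_mul,
      Matrix.add_apply]
    ring
  zero_mem' := by
    refine ⟨0, 0, ?_⟩
    ext p
    simp [ofMat]
  smul_mem' := by
    rintro a _ ⟨X, Y, rfl⟩
    refine ⟨a • X, a • Y, ?_⟩
    ext p
    simp [ofMat, mul_add]

/-- The linear space of matrices supported on `Ω`. -/
def supportedOn {n₁ n₂ : ℕ} (Ω : Set (Fin n₁ × Fin n₂)) : Submodule ℝ (Frob n₁ n₂) where
  carrier := {Z | ∀ p, p ∉ Ω → Z p = 0}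
  add_mem' := by
    intro a b ha hb p hp
    simp [ha p hp, hb p hp]
  zero_mem' := by
    intro p _
    simp
  smul_mem' := by
    intro c a ha p hp
    simp [ha p hp]

/-- The orthogonal projection `P_T`. -/
def projT {n₁ n₂ r : ℕ} (U : Matrix (Fin n₁) (Fin r) ℝ) (V : Matrix (Fin n₂) (Fin r) ℝ) :
    Frob n₁ n₂ →L[ℝ] Frob n₁ n₂ :=
  (tangent U V).starProjection

/-- The orthogonal projection `P_{T⊥}` onto the orthogonal complement of `T`. -/
def projTperp {n₁ n₂ r : ℕ} (U : Matrix (Fin n₁) (Fin r) ℝ) (V : Matrix (Fin n₂) (Fin r) ℝ) :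
    Frob n₁ n₂ →L[ℝ] Frob n₁ n₂ :=
  (tangent U V)ᗮ.starProjection

/-- The orthogonal projection `P_Ω` onto the matrices supported on `Ω`. -/
def projΩ {n₁ n₂ : ℕ} (Ω : Set (Fin n₁ × Fin n₂)) : Frob n₁ n₂ →L[ℝ] Frob n₁ n₂ :=
  (supportedOn Ω).starProjection

/-- The operator `P_Ω - P_Ω P_T P_Ω`, as a linear map of the space of matrices supported on `Ω`
to itself. -/
def normalOp {n₁ n₂ r : ℕ} (U : Matrix (Fin n₁) (Fin r) ℝ) (V : Matrix (Fin n₂) (Fin r) ℝ)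
    (Ω : Set (Fin n₁ × Fin n₂)) : Module.End ℝ (supportedOn Ω) :=
  LinearMap.restrict
    ((projΩ Ω - projΩ Ω ∘L projT U V ∘L projΩ Ω : Frob n₁ n₂ →L[ℝ] Frob n₁ n₂) :
      Frob n₁ n₂ →ₗ[ℝ] Frob n₁ n₂)
    (fun _ _ => Submodule.sub_mem _ (Submodule.starProjection_apply_mem _ _)
      (Submodule.starProjection_apply_mem _ _))

/-- The support of a matrix. -/
def supp {n₁ n₂ : ℕ} (S : Matrix (Fin n₁) (Fin n₂) ℝ) : Set (Fin n₁ × Fin n₂) :=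
  {p | S p.1 p.2 ≠ 0}

/-- The sign matrix `sgn S`, an element of the space of matrices supported on `supp S`. -/
def sgn {n₁ n₂ : ℕ} (S : Matrix (Fin n₁) (Fin n₂) ℝ) : supportedOn (supp S) :=
  ⟨ofMat (S.map Real.sign), by
    intro p hp
    have h : S p.1 p.2 = 0 := by simpa [supp] using hp
    simp [ofMat, h]⟩

/-- `P_Ω - P_Ω P_T P_Ω`, with `Ω = supp S`, satisfies the condition `‖P_Ω P_T‖ < 1/2` under which
the least-squares certificate is formed, and is invertible on the matrices supported on `Ω`. -/
def WSDefined {n₁ n₂ r : ℕ} (U : Matrix (Fin n₁) (Fin r) ℝ) (V : Matrix (Fin n₂) (Fin r) ℝ)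
    (S : Matrix (Fin n₁) (Fin n₂) ℝ) : Prop :=
  ‖projΩ (supp S) ∘L projT U V‖ < 1 / 2 ∧ IsUnit (normalOp U V (supp S))

/-- The least-squares certificate `W^S = lam • P_{T⊥} (P_Ω - P_Ω P_T P_Ω)⁻¹ (sgn S)`,
`Ω = supp S`. `Ring.inverse` is the genuine inverse whenever `WSDefined U V S` holds. -/
def WS {n₁ n₂ r : ℕ} (lam : ℝ) (U : Matrix (Fin n₁) (Fin r) ℝ) (V : Matrix (Fin n₂) (Fin r) ℝ)
    (S : Matrix (Fin n₁) (Fin n₂) ℝ) : Frob n₁ n₂ :=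
  lam • projTperp U V (Ring.inverse (normalOp U V (supp S)) (sgn S) : Frob n₁ n₂)

/-- The random matrix `S` has Bernoulli support and i.i.d. symmetric signs: each entry belongs to
the support with probability `ρ`, independently of the others, and the signs of the entries on the
support are independent, `±1` with probability `1/2` each, and independent of the support (that
is, given the support they are uniformly distributed over all sign patterns on it). Nothing is
assumed about the magnitudes of the entries. -/
structure BernoulliRandomSigns {n₁ n₂ : ℕ} {X : Type*} [MeasurableSpace X] (P : Measure X) (ρ : ℝ)
    (S : X → Matrix (Fin n₁) (Fin n₂) ℝ) : Prop where
  measurable : ∀ i j, Measurable fun x => S x i j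
  prob : ∀ p : Fin n₁ × Fin n₂, P.real {x | p ∈ supp (S x)} = ρ
  indep : iIndepSet (fun p : Fin n₁ × Fin n₂ => {x | p ∈ supp (S x)}) P
  signs : ∀ (Ω : Finset (Fin n₁ × Fin n₂)) (e : Fin n₁ × Fin n₂ → ℝ), (∀ p, e p = 1 ∨ e p = -1) →
    P.real {x | supp (S x) = ↑Ω ∧ ∀ p ∈ Ω, Real.sign (S x p.1 p.2) = e p} =
      P.real {x | supp (S x) = ↑Ω} * (1 / 2 : ℝ) ^ Ω.card

end RobustPCA

end

/-! The event depends on `S₀` only through its sign matrix E, whose entries are independent, 0 with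
probability 1 - ρ and ±1 with probability ρ/2 each. Probabilities thus become finite sums of product
weights over sign patterns (`BernoulliRandomSigns.real_pattern_eq`). Write n for the larger
dimension and K = P_Ω P_T P_Ω.

Duality. If Y solves Y - K Y = E, then ⟨Z, Y⟩ = ⟨(1 - K)⁻¹ Z, E⟩ for every Z, because K is
self-adjoint (`inner_resolvent`). Both claims about W = λ P_{T⊥} Y become statements about linear
forms in E. For (a), P_{T⊥} does not increase the operator norm, and ‖Y‖ is controlled by ⟨y xᵀ, Y⟩
with x, y in 1/2-nets; this splits into the fixed form ⟨y xᵀ, E⟩ and a correction whose coefficients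
(1 - K)⁻¹ y xᵀ - y xᵀ are small. For (b), Y vanishes off Ω, so there W_k = -λ ⟨P_T e_k, Y⟩ = -λ ⟨(1
- K)⁻¹ P_T e_k, E⟩, and incoherence makes P_T e_k short.

Tails. Fixed forms are sub-Gaussian with variance proxy κ as small as desired once ρ is small
(`sum_patWeight_le_exp_of_linear`). The other coefficients depend on Ω alone, and given Ω the signs
are Rademacher, so a Hoeffding bound applies (`sum_patWeight_le_exp_of_support`). The exponential
tails outweigh the 25^n pairs of net points.

Norm of P_Ω P_T. The operator P_T P_Ω P_T is the sum of v_k v_kᵀ over k ∈ Ω, with v_k = P_T e_k and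
‖v_k‖² ≤ R. Its trace moments obey E tr A^(J+2) ≤ (ρ + (J+1)R) E tr A^(J+1)
(`sum_patWeight_frameMoment_succ_le`): delete k from Ω, pay for the rank-one change by Chebyshev's
association inequality, and use that k ∈ Ω is independent of Ω \ {k}. Markov's inequality with J
about 12 log n makes the norm at most 1/1000 outside an event of probability n⁻¹⁰. -/

namespace RobustPCA

/-! ### Product law on sign patterns and sub-Gaussian tails. -/

section SignPatterns

variable {ι : Type*} [Fintype ι] [DecidableEq ι]

/-- The law of one entry of the sign matrix: `0` with probability `1 - ρ`, `±1` with
probability `ρ / 2` each. -/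
noncomputable def signWeight (ρ : ℝ) (a : SignType) : ℝ := if a = 0 then 1 - ρ else ρ / 2

/-- The probability of a sign pattern with independent entries of law `signWeight ρ`. -/
noncomputable def patWeight (ρ : ℝ) (e : ι → SignType) : ℝ := ∏ p, signWeight ρ (e p)

lemma sum_signType {M : Type*} [AddCommMonoid M] (f : SignType → M) :
    ∑ a, f a = f 0 + (f 1 + f (-1)) := by
  have h : (Finset.univ : Finset SignType) = {0, 1, -1} := by decide
  rw [h, Finset.sum_insert (by decide), Finset.sum_insert (by decide), Finset.sum_singleton]

lemma signWeight_nonneg {ρ : ℝ} (h0 : 0 ≤ ρ) (h1 : ρ ≤ 1) (a : SignType) :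
    0 ≤ signWeight ρ a := by
  unfold signWeight
  split_ifs <;> linarith

omit [DecidableEq ι] in
lemma patWeight_nonneg {ρ : ℝ} (h0 : 0 ≤ ρ) (h1 : ρ ≤ 1) (e : ι → SignType) :
    0 ≤ patWeight ρ e :=
  Finset.prod_nonneg fun _ _ => signWeight_nonneg h0 h1 _

lemma signWeight_neg (ρ : ℝ) (a : SignType) : signWeight ρ (-a) = signWeight ρ a := by
  cases a <;> simp [signWeight]

lemma sum_signWeight (ρ : ℝ) : ∑ a, signWeight ρ a = 1 := by
  simp [sum_signType, signWeight]

lemma sum_patWeight_mul_prod (ρ : ℝ) (f : ι → SignType → ℝ) :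
    ∑ e : ι → SignType, patWeight ρ e * ∏ p, f p (e p) = ∏ p, ∑ a, signWeight ρ a * f p a := by
  rw [Fintype.prod_sum]
  simp only [patWeight, Finset.prod_mul_distrib]

/-- Exchanging entry `k` with an independent copy preserves the joint weight; the product form
avoids dividing by a weight that may vanish. -/
lemma patWeight_update (ρ : ℝ) (e : ι → SignType) (k : ι) (a : SignType) :
    patWeight ρ (Function.update e k a) * signWeight ρ (e k) =
      patWeight ρ e * signWeight ρ a := by
  unfold patWeight
  rw [← Finset.mul_prod_erase _ _ (Finset.mem_univ k),
    ← Finset.mul_prod_erase _ _ (Finset.mem_univ k)]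
  have : ∏ x ∈ Finset.univ.erase k, signWeight ρ (Function.update e k a x) =
      ∏ x ∈ Finset.univ.erase k, signWeight ρ (e x) :=
    Finset.prod_congr rfl fun x hx => by
      rw [Function.update_of_ne (Finset.ne_of_mem_erase hx)]
  rw [this, Function.update_self]
  ring

/-- An entry is independent of anything determined by the other entries. -/
lemma sum_patWeight_mul_of_update (ρ : ℝ) (k : ι) (f : SignType → ℝ) (h : (ι → SignType) → ℝ)
    (hh : ∀ e a, h (Function.update e k a) = h e) :
    ∑ e, patWeight ρ e * (f (e k) * h e) =
      (∑ a, signWeight ρ a * f a) * ∑ e, patWeight ρ e * h e := by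
  have h1 : ∑ e, patWeight ρ e * (f (e k) * h e) =
      ∑ q : (ι → SignType) × SignType,
        patWeight ρ q.1 * signWeight ρ q.2 * (f (q.1 k) * h q.1) := by
    rw [Fintype.sum_prod_type]
    refine Finset.sum_congr rfl fun e _ => ?_
    dsimp only
    rw [← Finset.sum_mul, ← Finset.mul_sum, sum_signWeight, mul_one]
  -- A fresh copy of entry `k` has been adjoined; swapping it with the original preserves the weight
  -- and is invisible to `h`.
  let φ : (ι → SignType) × SignType → (ι → SignType) × SignType :=
    fun q => (Function.update q.1 k q.2, q.1 k)
  have hφ : Function.Involutive φ := by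
    rintro ⟨e, a⟩
    simp [φ]
  rw [h1, ← Equiv.sum_comp hφ.toPerm, Fintype.sum_prod_type_right, Finset.sum_mul]
  refine Finset.sum_congr rfl fun a _ => ?_
  rw [Finset.mul_sum]
  refine Finset.sum_congr rfl fun e _ => ?_
  simp only [Function.Involutive.coe_toPerm, φ, patWeight_update, Function.update_self, hh]
  ring

lemma sum_patWeight (ρ : ℝ) : ∑ e : ι → SignType, patWeight ρ e = 1 := by
  have := sum_patWeight_mul_prod (ι := ι) ρ fun _ _ => 1
  simpa [sum_signWeight] using this

/-- Markov's inequality for sign patterns. -/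
lemma sum_patWeight_filter_le {ρ : ℝ} (h0 : 0 ≤ ρ) (h1 : ρ ≤ 1)
    (B : (ι → SignType) → Prop) [DecidablePred B] (F : (ι → SignType) → ℝ)
    (hF : ∀ e, 0 ≤ F e) (hB : ∀ e, B e → 1 ≤ F e) :
    ∑ e with B e, patWeight ρ e ≤ ∑ e, patWeight ρ e * F e := by
  rw [Finset.sum_filter]
  refine Finset.sum_le_sum fun e _ => ?_
  split_ifs with h
  · exact le_mul_of_one_le_right (patWeight_nonneg h0 h1 e) (hB e h)
  · exact mul_nonneg (patWeight_nonneg h0 h1 e) (hF e)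

/-- The left side is the moment generating function of one entry. For |s| ≤ 2/κ the factor ρ absorbs
e^(s²/2) ≤ e^(2/κ²); for |s| ≥ 2/κ already cosh s ≤ e^|s| ≤ e^(κs²/2). This is how a small ρ buys an
arbitrarily small variance proxy. -/
lemma one_add_mul_cosh_sub_one_le {ρ κ : ℝ} (hκ : 0 < κ) (h0 : 0 ≤ ρ) (h1 : ρ ≤ 1)
    (h : ρ ≤ κ * Real.exp (-(2 / κ ^ 2))) (s : ℝ) :
    1 + ρ * (Real.cosh s - 1) ≤ Real.exp (κ * s ^ 2 / 2) := by
  rcases le_total |s| (2 / κ) with hs | hs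
  · have e1 : Real.cosh s - 1 ≤ s ^ 2 / 2 * Real.exp (s ^ 2 / 2) := by
      have a := Real.cosh_le_exp_half_sq s
      have b := Real.add_one_le_exp (-(s ^ 2 / 2))
      have c : Real.exp (-(s ^ 2 / 2)) * Real.exp (s ^ 2 / 2) = 1 := by
        rw [← Real.exp_add]; simp
      nlinarith [Real.exp_pos (s ^ 2 / 2)]
    have e2 : Real.exp (s ^ 2 / 2) ≤ Real.exp (2 / κ ^ 2) := by
      apply Real.exp_le_exp.2
      have : s ^ 2 ≤ (2 / κ) ^ 2 := by
        rw [← sq_abs]; gcongr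
      calc s ^ 2 / 2 ≤ (2 / κ) ^ 2 / 2 := by gcongr
        _ = 2 / κ ^ 2 := by field_simp
    have e3 : ρ * Real.exp (2 / κ ^ 2) ≤ κ := by
      calc ρ * Real.exp (2 / κ ^ 2) ≤ κ * Real.exp (-(2 / κ ^ 2)) * Real.exp (2 / κ ^ 2) := by gcongr
        _ = κ := by rw [mul_assoc, ← Real.exp_add]; simp
    have e4 : ρ * (Real.cosh s - 1) ≤ κ * s ^ 2 / 2 := by
      calc ρ * (Real.cosh s - 1) ≤ ρ * (s ^ 2 / 2 * Real.exp (2 / κ ^ 2)) := by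
            gcongr; exact e1.trans (by gcongr)
        _ = (ρ * Real.exp (2 / κ ^ 2)) * (s ^ 2 / 2) := by ring
        _ ≤ κ * (s ^ 2 / 2) := by gcongr
        _ = _ := by ring
    linarith [Real.add_one_le_exp (κ * s ^ 2 / 2)]
  · have e1 : 1 + ρ * (Real.cosh s - 1) ≤ Real.cosh s := by
      nlinarith [Real.one_le_cosh s]
    have e2 : Real.cosh s ≤ Real.exp |s| := by
      rw [← Real.cosh_abs, Real.cosh_eq]
      have := Real.exp_le_exp.2 (show -|s| ≤ |s| by linarith [abs_nonneg s])
      linarith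
    refine e1.trans (e2.trans (Real.exp_le_exp.2 ?_))
    rw [div_le_iff₀ hκ] at hs
    rw [← sq_abs]
    nlinarith [abs_nonneg s]

/-- The moment generating function of a fixed linear form in the entries. -/
lemma sum_patWeight_mul_exp_le {ρ κ : ℝ} (hκ : 0 < κ) (h0 : 0 ≤ ρ) (h1 : ρ ≤ 1)
    (h : ρ ≤ κ * Real.exp (-(2 / κ ^ 2))) (s : ℝ) (a : ι → ℝ) :
    ∑ e : ι → SignType, patWeight ρ e * Real.exp (s * ∑ p, a p * (e p : ℝ)) ≤
      Real.exp (κ * s ^ 2 / 2 * ∑ p, a p ^ 2) := by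
  have e1 : ∀ e : ι → SignType, Real.exp (s * ∑ p, a p * (e p : ℝ)) =
      ∏ p, Real.exp (s * a p * (e p : ℝ)) := by
    intro e
    rw [← Real.exp_sum, Finset.mul_sum]
    simp only [mul_assoc]
  simp only [e1]
  rw [sum_patWeight_mul_prod ρ fun p x => Real.exp (s * a p * (x : ℝ)), Finset.mul_sum, Real.exp_sum]
  refine Finset.prod_le_prod (fun p _ => Finset.sum_nonneg fun x _ =>
    mul_nonneg (signWeight_nonneg h0 h1 x) (Real.exp_pos _).le) fun p _ => ?_
  have := one_add_mul_cosh_sub_one_le hκ h0 h1 h (s * a p)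
  rw [sum_signType]
  simp only [signWeight, SignType.coe_zero, SignType.coe_one, SignType.coe_neg]
  rw [Real.cosh_eq] at this
  refine le_of_eq_of_le ?_ (this.trans_eq ?_)
  · rw [if_pos trivial, if_neg (by decide), if_neg (by decide), mul_zero, Real.exp_zero,
      mul_one, mul_neg, mul_one]
    ring
  · congr 1; ring

/-- Sub-Gaussian tail of a fixed linear form in the entries. -/
lemma sum_patWeight_le_exp_of_linear {ρ κ : ℝ} (hκ : 0 < κ) (h0 : 0 ≤ ρ) (h1 : ρ ≤ 1)
    (h : ρ ≤ κ * Real.exp (-(2 / κ ^ 2))) (a : ι → ℝ) (ha : ∑ p, a p ^ 2 ≤ 1) {t : ℝ}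
    (ht : 0 ≤ t) :
    ∑ e : ι → SignType with t ≤ ∑ p, a p * (e p : ℝ), patWeight ρ e ≤
      Real.exp (-(t ^ 2 / (2 * κ))) := by
  refine (sum_patWeight_filter_le h0 h1 _
    -- Chernoff's method at the optimal parameter t/κ.
    (fun e => Real.exp (-(t / κ * t)) * Real.exp (t / κ * ∑ p, a p * (e p : ℝ)))
    (fun e => by positivity) fun e he => ?_).trans ?_
  · rw [← Real.exp_add]
    apply Real.one_le_exp
    have : t / κ * t ≤ t / κ * ∑ p, a p * (e p : ℝ) := by gcongr
    linarith
  · have := sum_patWeight_mul_exp_le hκ h0 h1 h (t / κ) a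
    calc ∑ e : ι → SignType, patWeight ρ e *
          (Real.exp (-(t / κ * t)) * Real.exp (t / κ * ∑ p, a p * (e p : ℝ)))
        = Real.exp (-(t / κ * t)) *
          ∑ e : ι → SignType, patWeight ρ e * Real.exp (t / κ * ∑ p, a p * (e p : ℝ)) := by
            rw [Finset.mul_sum]
            exact Finset.sum_congr rfl fun _ _ => by ring
      _ ≤ Real.exp (-(t / κ * t)) * Real.exp (κ * (t / κ) ^ 2 / 2 * 1) := by
            refine mul_le_mul_of_nonneg_left (this.trans ?_) (Real.exp_pos _).le
            gcongr
      _ = _ := by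
            rw [← Real.exp_add]
            congr 1
            field_simp
            ring

/-- Flip the signs of the entries marked by `b`. -/
def flipSigns (b : ι → Bool) (e : ι → SignType) : ι → SignType :=
  fun p => if b p then -e p else e p

omit [Fintype ι] [DecidableEq ι] in
lemma flipSigns_involutive (b : ι → Bool) : Function.Involutive (flipSigns b) := by
  intro e
  funext p
  unfold flipSigns
  split_ifs <;> simp

omit [DecidableEq ι] in
lemma patWeight_flipSigns (ρ : ℝ) (b : ι → Bool) (e : ι → SignType) :
    patWeight ρ (flipSigns b e) = patWeight ρ e := by
  unfold patWeight flipSigns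
  refine Finset.prod_congr rfl fun p _ => ?_
  split_ifs
  · exact signWeight_neg _ _
  · rfl

/-- Hoeffding's bound for Rademacher signs: the sum factorises into hyperbolic cosines. Zero entries
contribute a factor that only helps. -/
lemma sum_flipSigns_exp_le (e : ι → SignType) (a : ι → ℝ) (s : ℝ) :
    ∑ b : ι → Bool, Real.exp (s * ∑ p, a p * (flipSigns b e p : ℝ)) ≤
      2 ^ Fintype.card ι * Real.exp (s ^ 2 / 2 * ∑ p, a p ^ 2) := by
  have e1 : ∀ b : ι → Bool, Real.exp (s * ∑ p, a p * (flipSigns b e p : ℝ)) =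
      ∏ p, Real.exp (s * a p * ((if b p then -e p else e p : SignType) : ℝ)) := by
    intro b
    rw [← Real.exp_sum, Finset.mul_sum]
    simp only [mul_assoc, flipSigns]
  simp only [e1]
  rw [← Fintype.prod_sum fun p (c : Bool) =>
    Real.exp (s * a p * ((if c then -e p else e p : SignType) : ℝ)), Finset.mul_sum, Real.exp_sum,
    ← Finset.card_univ, ← Finset.prod_const, ← Finset.prod_mul_distrib]
  refine Finset.prod_le_prod (fun p _ => Finset.sum_nonneg fun x _ => (Real.exp_pos _).le)
    fun p _ => ?_
  have h1 := Real.cosh_le_exp_half_sq (s * a p * (e p : ℝ))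
  have h2 : (s * a p * (e p : ℝ)) ^ 2 / 2 ≤ s ^ 2 / 2 * a p ^ 2 := by
    have : ((e p : SignType) : ℝ) ^ 2 ≤ 1 := by cases e p <;> simp
    nlinarith [sq_nonneg (s * a p)]
  have h3 := Real.exp_le_exp.2 h2
  rw [Real.cosh_eq] at h1
  simp only [Fintype.sum_bool, if_true, SignType.coe_neg]
  simp only [Bool.false_eq_true, if_false, mul_neg]
  linarith

/-- Sub-Gaussian tail of a linear form in the signs, with coefficients determined by the
support. -/
lemma sum_patWeight_le_exp_of_support {ρ v t : ℝ} (h0 : 0 ≤ ρ) (h1 : ρ ≤ 1) (hv : 0 < v)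
    (ht : 0 ≤ t) (G : (ι → SignType) → Prop) [DecidablePred G] (a : (ι → SignType) → ι → ℝ)
    (hG : ∀ b e, G (flipSigns b e) ↔ G e) (ha : ∀ b e, a (flipSigns b e) = a e)
    (hav : ∀ e, G e → ∑ p, a e p ^ 2 ≤ v) :
    ∑ e : ι → SignType with G e ∧ t ≤ ∑ p, a e p * (e p : ℝ), patWeight ρ e ≤
      Real.exp (-(t ^ 2 / (2 * v))) := by
  set F : (ι → SignType) → ℝ := fun e => if G e then
    Real.exp (-(t / v * t)) * Real.exp (t / v * ∑ p, a e p * (e p : ℝ)) else 0 with hF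
  refine (sum_patWeight_filter_le h0 h1 _ F
    (fun e => by simp only [hF]; split_ifs <;> positivity) fun e he => ?_).trans ?_
  · simp only [hF, if_pos he.1]
    rw [← Real.exp_add]
    apply Real.one_le_exp
    have : t / v * t ≤ t / v * ∑ p, a e p * (e p : ℝ) :=
      mul_le_mul_of_nonneg_left he.2 (by positivity)
    linarith
  -- Averaging over all flips replaces conditioning on the support: flips preserve the weight, the
  -- support and hence the coefficients.
  · have k1 : (2 : ℝ) ^ Fintype.card ι * ∑ e, patWeight ρ e * F e =
        ∑ e, patWeight ρ e * ∑ b : ι → Bool, F (flipSigns b e) := by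
      simp only [Finset.mul_sum]
      rw [Finset.sum_comm (s := Finset.univ)]
      have : ∀ b : ι → Bool, ∑ e, patWeight ρ e * F (flipSigns b e) = ∑ e, patWeight ρ e * F e := by
        intro b
        rw [← Equiv.sum_comp (flipSigns_involutive b).toPerm fun e => patWeight ρ e * F e]
        simp only [Function.Involutive.coe_toPerm, patWeight_flipSigns]
      simp only [this]
      rw [← Finset.mul_sum]
      simp
    have k2 : ∀ e, ∑ b : ι → Bool, F (flipSigns b e) ≤
        2 ^ Fintype.card ι * Real.exp (-(t ^ 2 / (2 * v))) := by
      intro e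
      by_cases he : G e
      · simp only [hF, hG, he, if_true, ha, ← Finset.mul_sum]
        calc _ ≤ Real.exp (-(t / v * t)) *
              (2 ^ Fintype.card ι * Real.exp ((t / v) ^ 2 / 2 * ∑ p, a e p ^ 2)) := by
                gcongr
                exact sum_flipSigns_exp_le e (a e) (t / v)
          _ ≤ Real.exp (-(t / v * t)) * (2 ^ Fintype.card ι * Real.exp ((t / v) ^ 2 / 2 * v)) := by
                gcongr
                exact hav e he
          _ = _ := by
                rw [mul_left_comm, ← Real.exp_add]
                congr 2
                field_simp
                ring
      · simp only [hF, hG, he, if_false, Finset.sum_const_zero]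
        positivity
    have k3 : (2 : ℝ) ^ Fintype.card ι * ∑ e, patWeight ρ e * F e ≤
        2 ^ Fintype.card ι * Real.exp (-(t ^ 2 / (2 * v))) := by
      rw [k1]
      calc _ ≤ ∑ e : ι → SignType, patWeight ρ e *
            (2 ^ Fintype.card ι * Real.exp (-(t ^ 2 / (2 * v)))) :=
            Finset.sum_le_sum fun e _ => mul_le_mul_of_nonneg_left (k2 e)
              (patWeight_nonneg h0 h1 e)
        _ = _ := by rw [← Finset.sum_mul, sum_patWeight, one_mul]
    exact le_of_mul_le_mul_left k3 (by positivity)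

end SignPatterns

end RobustPCA

namespace RobustPCA

/-! ### Moments of a positive operator under a rank-one update. -/

section RankOneUpdate

variable {E : Type*} [NormedAddCommGroup E] [InnerProductSpace ℝ E]

/-- The telescoping identity A^J - B^J = ∑ A^i (A - B) B^(J-1-i) with A - B = v vᵀ, paired with `v`
and `z`. -/
lemma inner_pow_rankOne_update (A B : Module.End ℝ E) (v : E)
    (h : ∀ x, A x = B x + inner ℝ v x • v) (J : ℕ) (z : E) :
    inner ℝ v ((A ^ J) z) = inner ℝ v ((B ^ J) z) +
      ∑ i ∈ Finset.range J, inner ℝ v ((A ^ i) v) * inner ℝ v ((B ^ (J - 1 - i)) z) := by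
  induction J generalizing z with
  | zero => simp
  | succ J ih =>
    have e1 : (A ^ (J + 1)) z = (A ^ J) (B z) + inner ℝ v z • (A ^ J) v := by
      rw [pow_succ, Module.End.mul_apply, h, map_add, map_smul]
    rw [e1, inner_add_right, inner_smul_right, ih (B z), Finset.sum_range_succ, pow_succ,
      Module.End.mul_apply]
    have e2 : ∀ i ∈ Finset.range J, inner ℝ v ((A ^ i) v) * inner ℝ v ((B ^ (J - 1 - i)) (B z)) =
        inner ℝ v ((A ^ i) v) * inner ℝ v ((B ^ (J + 1 - 1 - i)) z) := by
      intro i hi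
      have : J + 1 - 1 - i = J - 1 - i + 1 := by
        have := Finset.mem_range.1 hi
        omega
      rw [this, pow_succ, Module.End.mul_apply]
    rw [Finset.sum_congr rfl e2]
    simp
    ring

variable [FiniteDimensional ℝ E]

/-- The moments of a positive operator at a vector, through its spectral decomposition. -/
lemma exists_spectral_moments (A : Module.End ℝ E) (hA : A.IsSymmetric)
    (hpos : ∀ x, 0 ≤ inner ℝ x (A x)) :
    ∃ (f : OrthonormalBasis (Fin (Module.finrank ℝ E)) ℝ E) (l : Fin (Module.finrank ℝ E) → ℝ),
      (∀ i, 0 ≤ l i) ∧ (∀ i, A (f i) = l i • f i) ∧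
      ∀ (J : ℕ) (x : E), inner ℝ x ((A ^ J) x) = ∑ i, l i ^ J * inner ℝ (f i) x ^ 2 := by
  refine ⟨hA.eigenvectorBasis rfl, hA.eigenvalues rfl, fun i => ?_, fun i => ?_, fun J x => ?_⟩
  · have h := hpos (hA.eigenvectorBasis rfl i)
    rw [hA.apply_eigenvectorBasis] at h
    simpa [inner_smul_right] using h
  · simp
  · set f := hA.eigenvectorBasis rfl
    have hp : ∀ i, (A ^ J) (f i) = hA.eigenvalues rfl i ^ J • f i := by
      intro i
      induction J with
      | zero => simp
      | succ J ih =>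
        have h := hA.apply_eigenvectorBasis rfl i
        rw [pow_succ, Module.End.mul_apply, h, map_smul, ih, smul_smul, pow_succ, mul_comm]
        simp
    conv_lhs => rw [← f.sum_repr' x, map_sum, f.sum_repr' x, inner_sum]
    refine Finset.sum_congr rfl fun i _ => ?_
    rw [map_smul, hp, inner_smul_right, inner_smul_right, real_inner_comm]
    ring

lemma inner_pow_nonneg (A : Module.End ℝ E) (hA : A.IsSymmetric)
    (hpos : ∀ x, 0 ≤ inner ℝ x (A x)) (J : ℕ) (x : E) : 0 ≤ inner ℝ x ((A ^ J) x) := by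
  obtain ⟨f, l, hl, -, h⟩ := exists_spectral_moments A hA hpos
  rw [h]
  exact Finset.sum_nonneg fun i _ => mul_nonneg (pow_nonneg (hl i) _) (sq_nonneg _)

/-- Chebyshev's association inequality for the moments of a positive operator. -/
lemma inner_pow_mul_inner_pow_le (A : Module.End ℝ E) (hA : A.IsSymmetric)
    (hpos : ∀ x, 0 ≤ inner ℝ x (A x)) (i j : ℕ) (x : E) :
    inner ℝ x ((A ^ i) x) * inner ℝ x ((A ^ j) x) ≤ ‖x‖ ^ 2 * inner ℝ x ((A ^ (i + j)) x) := by
  obtain ⟨f, l, hl, -, h⟩ := exists_spectral_moments A hA hpos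
  have h0 : ‖x‖ ^ 2 = ∑ a, inner ℝ (f a) x ^ 2 := by
    have := h 0 x
    simpa using this
  rw [h0, h, h, h, Finset.sum_mul_sum, Finset.sum_mul_sum]
  have key : ∀ a b, 0 ≤ (l a ^ i - l b ^ i) * (l a ^ j - l b ^ j) := by
    intro a b
    rcases le_total (l a) (l b) with hab | hab
    · exact mul_nonneg_of_nonpos_of_nonpos (sub_nonpos.2 (pow_le_pow_left₀ (hl a) hab i))
        (sub_nonpos.2 (pow_le_pow_left₀ (hl a) hab j))
    · exact mul_nonneg (sub_nonneg.2 (pow_le_pow_left₀ (hl b) hab i))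
        (sub_nonneg.2 (pow_le_pow_left₀ (hl b) hab j))
  set c : Fin (Module.finrank ℝ E) → ℝ := fun a => inner ℝ (f a) x ^ 2 with hc
  -- Powers of nonnegative eigenvalues are similarly ordered; this symmetrised sum is twice the
  -- difference of the two sides.
  have hs : 0 ≤ ∑ a, ∑ b, c a * c b * ((l a ^ i - l b ^ i) * (l a ^ j - l b ^ j)) :=
    Finset.sum_nonneg fun a _ => Finset.sum_nonneg fun b _ =>
      mul_nonneg (mul_nonneg (sq_nonneg _) (sq_nonneg _)) (key a b)
  have e1 : ∑ a, ∑ b, c a * c b * ((l a ^ i - l b ^ i) * (l a ^ j - l b ^ j)) =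
      (∑ a, ∑ b, c a * (l b ^ (i + j) * c b) + ∑ a, ∑ b, c b * (l a ^ (i + j) * c a)) -
      (∑ a, ∑ b, l a ^ i * c a * (l b ^ j * c b) + ∑ a, ∑ b, l b ^ i * c b * (l a ^ j * c a)) := by
    simp only [← Finset.sum_add_distrib, ← Finset.sum_sub_distrib]
    exact Finset.sum_congr rfl fun a _ => Finset.sum_congr rfl fun b _ => by ring
  have e2 : ∑ a, ∑ b, c b * (l a ^ (i + j) * c a) = ∑ a, ∑ b, c a * (l b ^ (i + j) * c b) :=
    Finset.sum_comm
  have e3 : ∑ a, ∑ b, l b ^ i * c b * (l a ^ j * c a) = ∑ a, ∑ b, l a ^ i * c a * (l b ^ j * c b) :=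
    Finset.sum_comm
  change ∑ a, ∑ b, l a ^ i * c a * (l b ^ j * c b) ≤ ∑ a, ∑ b, c a * (l b ^ (i + j) * c b)
  linarith

/-- The moments of a positive operator at `v`, before and after adding `v v*`. -/
lemma inner_pow_rankOne_update_bounds (A B : Module.End ℝ E) (v : E)
    (h : ∀ x, A x = B x + inner ℝ v x • v) (hA : A.IsSymmetric)
    (hApos : ∀ x, 0 ≤ inner ℝ x (A x)) (hB : B.IsSymmetric) (hBpos : ∀ x, 0 ≤ inner ℝ x (B x))
    (J : ℕ) :
    inner ℝ v ((B ^ J) v) ≤ inner ℝ v ((A ^ J) v) ∧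
    inner ℝ v ((A ^ (J + 1)) v) ≤ inner ℝ v ((B ^ (J + 1)) v) +
      (J + 1 : ℕ) * (‖v‖ ^ 2 * inner ℝ v ((A ^ J) v)) := by
  have mono : ∀ J : ℕ, inner ℝ v ((B ^ J) v) ≤ inner ℝ v ((A ^ J) v) := by
    intro J
    rw [inner_pow_rankOne_update A B v h J v]
    exact le_add_of_nonneg_right (Finset.sum_nonneg fun i _ =>
      mul_nonneg (inner_pow_nonneg A hA hApos _ _) (inner_pow_nonneg B hB hBpos _ _))
  refine ⟨mono J, ?_⟩
  rw [inner_pow_rankOne_update A B v h (J + 1) v]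
  gcongr
  -- In each cross term B is replaced by A, then association merges the two moments into one of
  -- order J; there are J + 1 such terms.
  calc _ ≤ ∑ i ∈ Finset.range (J + 1), ‖v‖ ^ 2 * inner ℝ v ((A ^ J) v) := by
        refine Finset.sum_le_sum fun i hi => ?_
        have hi' := Finset.mem_range.1 hi
        have e : i + (J + 1 - 1 - i) = J := by omega
        calc _ ≤ inner ℝ v ((A ^ i) v) * inner ℝ v ((A ^ (J + 1 - 1 - i)) v) :=
              mul_le_mul_of_nonneg_left (mono _) (inner_pow_nonneg A hA hApos _ _)
          _ ≤ _ := by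
              have := inner_pow_mul_inner_pow_le A hA hApos i (J + 1 - 1 - i) v
              rwa [e] at this
    _ = _ := by simp

end RankOneUpdate

/-! ### Trace moments of a randomly sampled Parseval frame. -/

section SampledFrame

variable {E : Type*} [NormedAddCommGroup E] [InnerProductSpace ℝ E]
  {ι : Type*} [Fintype ι] [DecidableEq ι]

/-- The frame operator `∑ k ∈ s, v k (v k)*`. -/
noncomputable def frameOp (v : ι → E) (s : Finset ι) : Module.End ℝ E :=
  ∑ k ∈ s, (innerₛₗ ℝ (v k)).smulRight (v k)

omit [Fintype ι] [DecidableEq ι] in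
lemma frameOp_apply (v : ι → E) (s : Finset ι) (x : E) :
    frameOp v s x = ∑ k ∈ s, inner ℝ (v k) x • v k := by
  simp [frameOp, LinearMap.sum_apply]

omit [Fintype ι] [DecidableEq ι] in
lemma inner_frameOp (v : ι → E) (s : Finset ι) (x y : E) :
    inner ℝ y (frameOp v s x) = ∑ k ∈ s, inner ℝ (v k) x * inner ℝ (v k) y := by
  rw [frameOp_apply, inner_sum]
  refine Finset.sum_congr rfl fun k _ => ?_
  rw [inner_smul_right, real_inner_comm y]

omit [Fintype ι] [DecidableEq ι] in
lemma frameOp_isSymmetric (v : ι → E) (s : Finset ι) : (frameOp v s).IsSymmetric := by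
  intro x y
  rw [real_inner_comm, inner_frameOp, inner_frameOp]
  exact Finset.sum_congr rfl fun _ _ => mul_comm _ _

omit [Fintype ι] [DecidableEq ι] in
lemma inner_frameOp_self_nonneg (v : ι → E) (s : Finset ι) (x : E) :
    0 ≤ inner ℝ x (frameOp v s x) := by
  rw [inner_frameOp]
  exact Finset.sum_nonneg fun k _ => mul_self_nonneg _

omit [Fintype ι] in
lemma frameOp_erase (v : ι → E) (s : Finset ι) {k : ι} (hk : k ∈ s) (x : E) :
    frameOp v s x = frameOp v (s.erase k) x + inner ℝ (v k) x • v k := by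
  rw [frameOp_apply, frameOp_apply, Finset.sum_erase_add _ _ hk]

/-- The trace of the power `J + 1` of the frame operator. -/
noncomputable def frameMoment (v : ι → E) (J : ℕ) (s : Finset ι) : ℝ :=
  ∑ k ∈ s, inner ℝ (v k) ((frameOp v s ^ J) (v k))

/-- The support of a sign pattern. -/
def patSupp (e : ι → SignType) : Finset ι := {p | e p ≠ 0}

variable [FiniteDimensional ℝ E]

omit [Fintype ι] [DecidableEq ι] in
lemma frameMoment_nonneg (v : ι → E) (J : ℕ) (s : Finset ι) : 0 ≤ frameMoment v J s :=
  Finset.sum_nonneg fun k _ => inner_pow_nonneg _ (frameOp_isSymmetric v s)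
    (inner_frameOp_self_nonneg v s) J (v k)

omit [DecidableEq ι] [FiniteDimensional ℝ E] in
/-- For a Parseval frame of its span, the full sum of moments is again a trace. -/
lemma sum_inner_frameOp_pow (v : ι → E) (hv : ∀ l, ∑ k, inner ℝ (v k) (v l) • v k = v l)
    (J : ℕ) (s : Finset ι) :
    ∑ k, inner ℝ (v k) ((frameOp v s ^ (J + 1)) (v k)) = frameMoment v J s := by
  unfold frameMoment
  have h1 : ∀ k, inner ℝ (v k) ((frameOp v s ^ (J + 1)) (v k)) =
      ∑ l ∈ s, inner ℝ (inner ℝ (v k) (v l) • v k) ((frameOp v s ^ J) (v l)) := by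
    intro k
    rw [pow_succ, Module.End.mul_apply, frameOp_apply, map_sum, inner_sum]
    refine Finset.sum_congr rfl fun l _ => ?_
    rw [map_smul, inner_smul_right, real_inner_smul_left, real_inner_comm]
  simp only [h1]
  rw [Finset.sum_comm]
  refine Finset.sum_congr rfl fun l _ => ?_
  rw [← sum_inner, hv]

omit [Fintype ι] [DecidableEq ι] in
/-- The frame operator is bounded through its trace moments. -/
lemma inner_frameOp_le_of_frameMoment_lt (v : ι → E) (J : ℕ) (s : Finset ι) {c : ℝ} (hc : 0 ≤ c)
    (h : frameMoment v J s < c ^ (J + 1)) (x : E) :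
    inner ℝ x (frameOp v s x) ≤ c * ‖x‖ ^ 2 := by
  obtain ⟨f, l, hl, hf, hm⟩ := exists_spectral_moments (frameOp v s) (frameOp_isSymmetric v s)
    (inner_frameOp_self_nonneg v s)
  -- The squared coefficients of the frame vectors along an eigenvector sum to its eigenvalue, which
  -- supplies the extra power. Each eigenvalue is then dominated by the trace.
  have htr : frameMoment v J s = ∑ i, l i ^ (J + 1) := by
    unfold frameMoment
    simp only [hm]
    rw [Finset.sum_comm]
    refine Finset.sum_congr rfl fun i _ => ?_
    have e1 : l i = ∑ k ∈ s, inner ℝ (f i) (v k) ^ 2 := by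
      have := inner_frameOp v s (f i) (f i)
      rw [hf, inner_smul_right] at this
      simp only [real_inner_self_eq_norm_sq, OrthonormalBasis.norm_eq_one, one_pow, mul_one] at this
      rw [this]
      refine Finset.sum_congr rfl fun k _ => ?_
      rw [real_inner_comm, sq]
    rw [← Finset.mul_sum, ← e1, pow_succ]
  have hlc : ∀ i, l i ≤ c := by
    intro i
    have : l i ^ (J + 1) ≤ c ^ (J + 1) := by
      refine le_trans ?_ h.le
      rw [htr]
      exact Finset.single_le_sum (f := fun i => l i ^ (J + 1))
        (fun i _ => pow_nonneg (hl i) _) (Finset.mem_univ i)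
    exact le_of_pow_le_pow_left₀ (by omega) hc this
  have h1 := hm 1 x
  have h0 := hm 0 x
  simp only [pow_one, pow_zero, one_mul, Module.End.one_apply, real_inner_self_eq_norm_sq] at h1 h0
  rw [h1, h0, Finset.mul_sum]
  exact Finset.sum_le_sum fun i _ => mul_le_mul_of_nonneg_right (hlc i) (sq_nonneg _)

-- The support away from `k` is independent of whether `k` is in it, an event of probability ρ.
omit [FiniteDimensional ℝ E] in
lemma sum_patWeight_indicator_mul {ρ : ℝ} (k : ι) (h : Finset ι → ℝ) :
    ∑ e, patWeight ρ e * (if k ∈ patSupp e then h ((patSupp e).erase k) else 0) =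
      ρ * ∑ e, patWeight ρ e * h ((patSupp e).erase k) := by
  have := sum_patWeight_mul_of_update ρ k (fun a => if a = 0 then 0 else 1)
    (fun e => h ((patSupp e).erase k)) (by
      intro e a
      congr 1
      ext p
      by_cases hp : p = k
      · simp [hp]
      · simp [patSupp, hp])
  have e2 : ∑ a, signWeight ρ a * (if a = 0 then 0 else 1) = ρ := by
    simp [sum_signType, signWeight]
  rw [e2] at this
  rw [← this]
  refine Finset.sum_congr rfl fun e _ => ?_
  by_cases hk : e k = 0 <;> simp [patSupp, hk]

/-- One step of the moment recursion. -/
lemma sum_patWeight_frameMoment_succ_le {ρ R : ℝ} (h0 : 0 ≤ ρ) (h1 : ρ ≤ 1) (v : ι → E)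
    (hv : ∀ l, ∑ k, inner ℝ (v k) (v l) • v k = v l) (hR : ∀ k, ‖v k‖ ^ 2 ≤ R) (J : ℕ) :
    ∑ e, patWeight ρ e * frameMoment v (J + 1) (patSupp e) ≤
      (ρ + (J + 1 : ℕ) * R) * ∑ e, patWeight ρ e * frameMoment v J (patSupp e) := by
  have upd := fun (s : Finset ι) (k : ι) (hk : k ∈ s) (J : ℕ) =>
    inner_pow_rankOne_update_bounds (frameOp v s) (frameOp v (s.erase k)) (v k)
      (frameOp_erase v s hk) (frameOp_isSymmetric v s) (inner_frameOp_self_nonneg v s)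
      (frameOp_isSymmetric v _) (inner_frameOp_self_nonneg v _) J
  have mom := fun (s : Finset ι) (k : ι) (J : ℕ) => inner_pow_nonneg (frameOp v s)
    (frameOp_isSymmetric v s) (inner_frameOp_self_nonneg v s) J (v k)
  have step : ∀ s : Finset ι, frameMoment v (J + 1) s ≤
      (∑ k, if k ∈ s then inner ℝ (v k) ((frameOp v (s.erase k) ^ (J + 1)) (v k)) else 0) +
        (J + 1 : ℕ) * R * frameMoment v J s := by
    intro s
    unfold frameMoment
    rw [← Finset.sum_filter, Finset.filter_mem_eq_inter, Finset.univ_inter, Finset.mul_sum,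
      ← Finset.sum_add_distrib]
    refine Finset.sum_le_sum fun k hk => ((upd s k hk J).2).trans ?_
    have : ‖v k‖ ^ 2 * inner ℝ (v k) ((frameOp v s ^ J) (v k)) ≤
        R * inner ℝ (v k) ((frameOp v s ^ J) (v k)) :=
      mul_le_mul_of_nonneg_right (hR k) (mom s k J)
    rw [mul_assoc]
    gcongr
  have erase_le : ∀ (s : Finset ι) (k : ι),
      inner ℝ (v k) ((frameOp v (s.erase k) ^ (J + 1)) (v k)) ≤
        inner ℝ (v k) ((frameOp v s ^ (J + 1)) (v k)) := by
    intro s k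
    by_cases hk : k ∈ s
    · exact (upd s k hk (J + 1)).1
    · rw [Finset.erase_eq_of_notMem hk]
  calc _ ≤ ∑ e, patWeight ρ e * ((∑ k, if k ∈ patSupp e then
          inner ℝ (v k) ((frameOp v ((patSupp e).erase k) ^ (J + 1)) (v k)) else 0) +
          (J + 1 : ℕ) * R * frameMoment v J (patSupp e)) :=
        Finset.sum_le_sum fun e _ =>
          mul_le_mul_of_nonneg_left (step _) (patWeight_nonneg h0 h1 e)
    _ = (∑ k, ∑ e, patWeight ρ e * (if k ∈ patSupp e then
          inner ℝ (v k) ((frameOp v ((patSupp e).erase k) ^ (J + 1)) (v k)) else 0)) +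
          (J + 1 : ℕ) * R * ∑ e, patWeight ρ e * frameMoment v J (patSupp e) := by
        rw [Finset.sum_comm]
        simp only [mul_add, Finset.sum_add_distrib, Finset.mul_sum]
        congr 1
        exact Finset.sum_congr rfl fun e _ => by ring
    _ = ρ * (∑ e, patWeight ρ e * ∑ k,
          inner ℝ (v k) ((frameOp v ((patSupp e).erase k) ^ (J + 1)) (v k))) +
          (J + 1 : ℕ) * R * ∑ e, patWeight ρ e * frameMoment v J (patSupp e) := by
        congr 1
        simp only [fun k => sum_patWeight_indicator_mul (ρ := ρ) k fun s =>
          inner ℝ (v k) ((frameOp v s ^ (J + 1)) (v k)), Finset.mul_sum]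
        rw [Finset.sum_comm]
    _ ≤ ρ * (∑ e, patWeight ρ e * frameMoment v J (patSupp e)) +
          (J + 1 : ℕ) * R * ∑ e, patWeight ρ e * frameMoment v J (patSupp e) := by
        gcongr with e
        · exact patWeight_nonneg h0 h1 e
        -- After the factor ρ is extracted, `k` runs over all indices; restoring it to the support
        -- increases the moment, and Parseval lowers the order by one.
        · rw [← sum_inner_frameOp_pow v hv]
          exact Finset.sum_le_sum fun k _ => erase_le _ k
    _ = _ := by ring

lemma sum_patWeight_frameMoment_le {ρ R : ℝ} (h0 : 0 ≤ ρ) (h1 : ρ ≤ 1) (v : ι → E)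
    (hv : ∀ l, ∑ k, inner ℝ (v k) (v l) • v k = v l) (hR0 : 0 ≤ R) (hR : ∀ k, ‖v k‖ ^ 2 ≤ R)
    (hR1 : ∀ k, ‖v k‖ ^ 2 ≤ 1) (J : ℕ) :
    ∑ e, patWeight ρ e * frameMoment v J (patSupp e) ≤
      Fintype.card ι * (ρ + J * R) ^ (J + 1) := by
  -- With J fixed, every recursion factor ρ + (K+1)R is at most ρ + JR.
  suffices h : ∀ K ≤ J, ∑ e, patWeight ρ e * frameMoment v K (patSupp e) ≤
      Fintype.card ι * (ρ + J * R) ^ (K + 1) from h J le_rfl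
  intro K
  induction K with
  | zero =>
    intro _
    have e1 : ∀ e : ι → SignType, patWeight ρ e * frameMoment v 0 (patSupp e) =
        ∑ k, patWeight ρ e * (if k ∈ patSupp e then ‖v k‖ ^ 2 else 0) := by
      intro e
      rw [← Finset.mul_sum, ← Finset.sum_filter, Finset.filter_mem_eq_inter, Finset.univ_inter]
      simp [frameMoment]
    simp only [e1]
    rw [Finset.sum_comm]
    simp only [fun k => sum_patWeight_indicator_mul (ρ := ρ) k fun _ => ‖v k‖ ^ 2,
      ← Finset.sum_mul, sum_patWeight]
    rw [← Finset.mul_sum]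
    have : ∑ k, 1 * ‖v k‖ ^ 2 ≤ ∑ _k : ι, (1 : ℝ) :=
      Finset.sum_le_sum fun k _ => by rw [one_mul]; exact hR1 k
    have hJR : 0 ≤ J * R := by positivity
    calc ρ * ∑ k, 1 * ‖v k‖ ^ 2 ≤ (ρ + J * R) * ∑ _k : ι, (1 : ℝ) := by gcongr; linarith
      _ = _ := by simp; ring
  | succ K ih =>
    intro hK
    refine (sum_patWeight_frameMoment_succ_le h0 h1 v hv hR K).trans ?_
    have hKJ : ((K + 1 : ℕ) : ℝ) ≤ J := by exact_mod_cast hK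
    calc _ ≤ (ρ + J * R) * (Fintype.card ι * (ρ + J * R) ^ (K + 1)) := by
          refine mul_le_mul ?_ (ih (by omega)) ?_ (by positivity)
          · gcongr
          · exact Finset.sum_nonneg fun e _ => mul_nonneg (patWeight_nonneg h0 h1 e)
              (frameMoment_nonneg v K _)
      _ = _ := by ring

/-- Tail bound for the norm of the sampled frame operator. -/
lemma sum_patWeight_frameMoment_ge_le {ρ R c : ℝ} (h0 : 0 ≤ ρ) (h1 : ρ ≤ 1) (v : ι → E)
    (hv : ∀ l, ∑ k, inner ℝ (v k) (v l) • v k = v l) (hR0 : 0 ≤ R) (hR : ∀ k, ‖v k‖ ^ 2 ≤ R)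
    (hR1 : ∀ k, ‖v k‖ ^ 2 ≤ 1) (J : ℕ) (hc : 0 < c) :
    ∑ e : ι → SignType with c ^ (J + 1) ≤ frameMoment v J (patSupp e), patWeight ρ e ≤
      Fintype.card ι * ((ρ + J * R) / c) ^ (J + 1) := by
  refine (sum_patWeight_filter_le h0 h1 _
    (fun e => frameMoment v J (patSupp e) / c ^ (J + 1))
    (fun e => div_nonneg (frameMoment_nonneg _ _ _) (by positivity)) fun e he => ?_).trans ?_
  · rwa [one_le_div (by positivity)]
  · have := sum_patWeight_frameMoment_le h0 h1 v hv hR0 hR hR1 J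
    rw [div_pow, ← mul_div_assoc]
    simp only [← mul_div_assoc]
    rw [← Finset.sum_div]
    gcongr

end SampledFrame

end RobustPCA

namespace RobustPCA

/-! ### Half-nets of unit balls and operator norms. -/

section Nets

/-- The unit ball of a `d`-dimensional normed space has a `1/2`-net of at most `5 ^ d` points. -/
lemma exists_half_net (E : Type*) [NormedAddCommGroup E] [NormedSpace ℝ E]
    [FiniteDimensional ℝ E] :
    ∃ s : Finset E, s.card ≤ 5 ^ Module.finrank ℝ E ∧ (∀ x ∈ s, ‖x‖ ≤ 1) ∧
      ∀ x : E, ‖x‖ ≤ 1 → ∃ y ∈ s, ‖x - y‖ ≤ 1 / 2 := by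
  classical
  let Sep : Finset E → Prop := fun s => (∀ x ∈ s, ‖x‖ ≤ 1) ∧
    ∀ x ∈ s, ∀ y ∈ s, x ≠ y → 1 / 2 ≤ ‖x - y‖
  have card_le : ∀ s, Sep s → s.card ≤ 5 ^ Module.finrank ℝ E := by
    intro s hs
    -- Doubling gives a 1-separated set in the ball of radius 2, the normalisation of the packing
    -- bound 5^d.
    have hinj : Function.Injective fun x : E => (2 : ℝ) • x :=
      smul_right_injective E (by norm_num)
    rw [← Finset.card_image_of_injective s hinj]
    refine Besicovitch.card_le_of_separated _ (fun c hc => ?_) fun c hc d hd hcd => ?_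
    · obtain ⟨x, hx, rfl⟩ := Finset.mem_image.1 hc
      have := hs.1 x hx
      simp only [norm_smul, Real.norm_ofNat]
      linarith
    · obtain ⟨x, hx, rfl⟩ := Finset.mem_image.1 hc
      obtain ⟨y, hy, rfl⟩ := Finset.mem_image.1 hd
      have := hs.2 x hx y hy fun h => hcd (by rw [h])
      rw [← smul_sub, norm_smul, Real.norm_ofNat]
      linarith
  let Q : ℕ → Prop := fun m => ∃ s, Sep s ∧ s.card = m
  -- A separated set of largest cardinality is a net: an uncovered point could be added.
  have hQ : Q (Nat.findGreatest Q (5 ^ Module.finrank ℝ E)) :=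
    Nat.findGreatest_spec (P := Q) (Nat.zero_le _) ⟨∅, by simp [Sep], rfl⟩
  obtain ⟨s, hs, hcard⟩ := hQ
  refine ⟨s, card_le s hs, hs.1, fun x hx => ?_⟩
  by_contra! hcon
  have hxs : x ∉ s := fun h => by
    have := hcon x h
    norm_num at this
  have hins : Sep (insert x s) := by
    refine ⟨fun y hy => ?_, fun y hy z hz hyz => ?_⟩
    · rcases Finset.mem_insert.1 hy with rfl | hy
      · exact hx
      · exact hs.1 y hy
    · rcases Finset.mem_insert.1 hy with hy | hy <;> rcases Finset.mem_insert.1 hz with hz | hz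
      · exact absurd (hy.trans hz.symm) hyz
      · exact hy ▸ (hcon z hz).le
      · rw [norm_sub_rev]
        exact hz ▸ (hcon y hy).le
      · exact hs.2 y hy z hz hyz
  have := Nat.le_findGreatest (P := Q) (card_le _ hins) ⟨_, hins, rfl⟩
  rw [Finset.card_insert_of_notMem hxs, ← hcard] at this
  omega

/-- The norm of an operator, controlled on a pair of `1/2`-nets. -/
lemma norm_le_of_half_nets {E F : Type*} [NormedAddCommGroup E] [InnerProductSpace ℝ E]
    [NormedAddCommGroup F] [InnerProductSpace ℝ F] (f : E →L[ℝ] F) (s : Set E) (t : Set F)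
    (hs : ∀ x : E, ‖x‖ ≤ 1 → ∃ y ∈ s, ‖x - y‖ ≤ 1 / 2)
    (ht : ∀ x : F, ‖x‖ ≤ 1 → ∃ y ∈ t, ‖x - y‖ ≤ 1 / 2) {C : ℝ} (hC : 0 ≤ C)
    (h : ∀ x ∈ s, ∀ y ∈ t, inner ℝ y (f x) ≤ C) : ‖f‖ ≤ 4 * C := by
  have h1 : ∀ x ∈ s, ‖f x‖ ≤ 2 * C := by
    intro x hx
    by_cases h0 : ‖f x‖ = 0
    · rw [h0]
      positivity
    · set u := ‖f x‖⁻¹ • f x with hu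
      have hu1 : ‖u‖ = 1 := by
        rw [hu, norm_smul, norm_inv, norm_norm, inv_mul_cancel₀ h0]
      obtain ⟨y, hy, hyu⟩ := ht u hu1.le
      have e1 : inner ℝ u (f x) = ‖f x‖ := by
        rw [hu, real_inner_smul_left, real_inner_self_eq_norm_sq]
        field_simp
      have e2 : inner ℝ (u - y) (f x) ≤ 1 / 2 * ‖f x‖ :=
        (real_inner_le_norm _ _).trans (by gcongr)
      rw [inner_sub_left, e1] at e2
      linarith [h x hx y hy]
  have h2 : ‖f‖ ≤ 2 * C + 1 / 2 * ‖f‖ := by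
    refine ContinuousLinearMap.opNorm_le_of_unit_norm (by positivity) fun x hx => ?_
    obtain ⟨y, hy, hyx⟩ := hs x hx.le
    calc ‖f x‖ = ‖f y + f (x - y)‖ := by rw [← map_add]; simp
      _ ≤ ‖f y‖ + ‖f (x - y)‖ := norm_add_le _ _
      _ ≤ 2 * C + ‖f‖ * ‖x - y‖ := add_le_add (h1 y hy) (f.le_opNorm _)
      _ ≤ 2 * C + ‖f‖ * (1 / 2) := by gcongr
      _ = _ := by ring
  linarith

end Nets

end RobustPCA

namespace RobustPCA

/-! ### Projections, the resolvent of P_Ω P_T P_Ω, and duality. -/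

section Deterministic

variable {n₁ n₂ r : ℕ}

lemma toMat_ofMat (M : Matrix (Fin n₁) (Fin n₂) ℝ) : toMat (ofMat M) = M := rfl

lemma ofMat_toMat (Z : Frob n₁ n₂) : ofMat (toMat Z) = Z := rfl

lemma inner_frob (X Y : Frob n₁ n₂) : inner ℝ X Y = ∑ p, X p * Y p := by
  rw [PiLp.inner_apply]
  exact Finset.sum_congr rfl fun p _ => by simp [mul_comm]

lemma inner_ofMat (A B : Matrix (Fin n₁) (Fin n₂) ℝ) :
    inner ℝ (ofMat A) (ofMat B) = (A.transpose * B).trace := by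
  rw [inner_frob, Fintype.sum_prod_type_right]
  simp [ofMat, Matrix.trace, Matrix.mul_apply]

lemma projΩ_apply (Ω : Set (Fin n₁ × Fin n₂)) [DecidablePred (· ∈ Ω)] (Z : Frob n₁ n₂)
    (p : Fin n₁ × Fin n₂) : projΩ Ω Z p = if p ∈ Ω then Z p else 0 := by
  let W : Frob n₁ n₂ := WithLp.toLp 2 fun p => if p ∈ Ω then Z p else 0
  have hW : projΩ Ω Z = W := by
    refine (Submodule.eq_starProjection_of_mem_of_inner_eq_zero (fun p hp => ?_)
      fun X hX => ?_)
    · simp [W, hp]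
    · rw [inner_frob]
      refine Finset.sum_eq_zero fun p _ => ?_
      by_cases hp : p ∈ Ω
      · simp [W, hp]
      · simp [hX p hp]
  rw [hW]

/-- The orthogonal projection onto `T⊥` is `Z ↦ (1 - UUᵀ) Z (1 - VVᵀ)`. -/
lemma projTperp_eq {U : Matrix (Fin n₁) (Fin r) ℝ} {V : Matrix (Fin n₂) (Fin r) ℝ}
    (hU : U.transpose * U = 1) (hV : V.transpose * V = 1) (Z : Frob n₁ n₂) :
    projTperp U V Z =
      ofMat ((1 - U * U.transpose) * toMat Z * (1 - V * V.transpose)) := by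
  symm
  set M := toMat Z
  refine (Submodule.eq_starProjection_of_mem_orthogonal ?_ ?_).symm
  · rw [Submodule.mem_orthogonal]
    rintro _ ⟨X, Y, rfl⟩
    rw [inner_ofMat]
    have h1 : U.transpose * (1 - U * U.transpose) = 0 := by
      rw [Matrix.mul_sub, ← Matrix.mul_assoc, hU]; simp
    have h2 : (1 - V * V.transpose) * V = 0 := by
      rw [Matrix.sub_mul, Matrix.mul_assoc, hV]; simp
    rw [Matrix.transpose_add, Matrix.add_mul, Matrix.trace_add, Matrix.transpose_mul,
      Matrix.transpose_mul, Matrix.transpose_transpose, Matrix.transpose_transpose]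
    have e1 : X * U.transpose * ((1 - U * U.transpose) * M * (1 - V * V.transpose)) = 0 := by
      rw [Matrix.mul_assoc X, Matrix.mul_assoc (1 - U * U.transpose), ← Matrix.mul_assoc U.transpose,
        h1]
      simp
    have e2 : (V * Y.transpose * ((1 - U * U.transpose) * M * (1 - V * V.transpose))).trace = 0 := by
      rw [Matrix.mul_assoc V, Matrix.trace_mul_comm, ← Matrix.mul_assoc Y.transpose,
        Matrix.mul_assoc _ _ V, h2]
      simp
    rw [e1, e2]
    simp
  · apply Submodule.le_orthogonal_orthogonal
    -- Split M = UUᵀM + (1 - UUᵀ)M and retain only the VVᵀ part of the second summand.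
    refine ⟨M.transpose * U, (1 - U * U.transpose) * M * V, ?_⟩
    have : Z = ofMat M := rfl
    rw [this]
    have key : M - (1 - U * U.transpose) * M * (1 - V * V.transpose) =
        U * (M.transpose * U).transpose + (1 - U * U.transpose) * M * V * V.transpose := by
      rw [Matrix.transpose_mul, Matrix.transpose_transpose, Matrix.mul_sub, Matrix.mul_one,
        Matrix.mul_assoc _ V, Matrix.sub_mul 1 (U * U.transpose) M, Matrix.one_mul,
        Matrix.mul_assoc U]
      abel
    rw [← key]
    rfl

lemma projT_eq_sub (U : Matrix (Fin n₁) (Fin r) ℝ) (V : Matrix (Fin n₂) (Fin r) ℝ)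
    (Z : Frob n₁ n₂) : projT U V Z = Z - projTperp U V Z := by
  exact eq_sub_of_add_eq
    (Submodule.starProjection_add_starProjection_orthogonal (K := tangent U V) Z)

open scoped Matrix.Norms.L2Operator in
lemma opNorm_eq_l2 (M : Matrix (Fin n₁) (Fin n₂) ℝ) : opNorm M = ‖M‖ := rfl

-- An orthogonal projection Q satisfies QᵀQ = Q, so the C*-identity gives ‖Q‖² = ‖Q‖.
open scoped Matrix.Norms.L2Operator in
lemma l2_opNorm_one_sub_mul_transpose_le {U : Matrix (Fin n₁) (Fin r) ℝ}
    (hU : U.transpose * U = 1) : ‖1 - U * U.transpose‖ ≤ 1 := by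
  set Q := 1 - U * U.transpose with hQ
  have h1 : Q.conjTranspose * Q = Q := by
    rw [Matrix.conjTranspose_eq_transpose_of_trivial]
    have e1 : Q.transpose = Q := by simp [hQ]
    have e2 : U.transpose * Q = 0 := by
      rw [hQ, Matrix.mul_sub, ← Matrix.mul_assoc, hU]; simp
    rw [e1]
    nth_rw 1 [hQ]
    rw [Matrix.sub_mul, Matrix.mul_assoc, e2]
    simp
  have h2 := Matrix.l2_opNorm_conjTranspose_mul_self Q
  rw [h1] at h2
  nlinarith [norm_nonneg Q]

open scoped Matrix.Norms.L2Operator in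
lemma opNorm_projTperp_le {U : Matrix (Fin n₁) (Fin r) ℝ} {V : Matrix (Fin n₂) (Fin r) ℝ}
    (hU : U.transpose * U = 1) (hV : V.transpose * V = 1) (Z : Frob n₁ n₂) :
    opNorm (toMat (projTperp U V Z)) ≤ opNorm (toMat Z) := by
  rw [projTperp_eq hU hV, toMat_ofMat, opNorm_eq_l2, opNorm_eq_l2]
  calc _ ≤ ‖(1 - U * U.transpose) * toMat Z‖ * ‖1 - V * V.transpose‖ := Matrix.l2_opNorm_mul _ _
    _ ≤ (‖1 - U * U.transpose‖ * ‖toMat Z‖) * 1 :=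
        mul_le_mul (Matrix.l2_opNorm_mul _ _) (l2_opNorm_one_sub_mul_transpose_le hV)
          (norm_nonneg _) (by positivity)
    _ ≤ (1 * ‖toMat Z‖) * 1 := by
        gcongr
        exact l2_opNorm_one_sub_mul_transpose_le hU
    _ = _ := by ring

/-- The projections onto `T` of the canonical basis of the matrix space. -/
noncomputable def basisT (U : Matrix (Fin n₁) (Fin r) ℝ) (V : Matrix (Fin n₂) (Fin r) ℝ)
    (k : Fin n₁ × Fin n₂) : Frob n₁ n₂ := projT U V (EuclideanSpace.single k 1)

lemma inner_projT_left (U : Matrix (Fin n₁) (Fin r) ℝ) (V : Matrix (Fin n₂) (Fin r) ℝ)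
    (X Y : Frob n₁ n₂) : inner ℝ (projT U V X) Y = inner ℝ X (projT U V Y) :=
  Submodule.inner_starProjection_left_eq_right _ X Y

lemma inner_projΩ_left (Ω : Set (Fin n₁ × Fin n₂)) (X Y : Frob n₁ n₂) :
    inner ℝ (projΩ Ω X) Y = inner ℝ X (projΩ Ω Y) :=
  Submodule.inner_starProjection_left_eq_right _ X Y

lemma projT_projT (U : Matrix (Fin n₁) (Fin r) ℝ) (V : Matrix (Fin n₂) (Fin r) ℝ)
    (X : Frob n₁ n₂) : projT U V (projT U V X) = projT U V X :=
  Submodule.starProjection_eq_self_iff.2 (Submodule.starProjection_apply_mem _ _)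

lemma inner_basisT (U : Matrix (Fin n₁) (Fin r) ℝ) (V : Matrix (Fin n₂) (Fin r) ℝ)
    (k : Fin n₁ × Fin n₂) (X : Frob n₁ n₂) : inner ℝ (basisT U V k) X = projT U V X k := by
  rw [basisT, inner_projT_left, EuclideanSpace.inner_single_left]
  simp

lemma sum_inner_basisT_smul (U : Matrix (Fin n₁) (Fin r) ℝ) (V : Matrix (Fin n₂) (Fin r) ℝ)
    (l : Fin n₁ × Fin n₂) :
    ∑ k, inner ℝ (basisT U V k) (basisT U V l) • basisT U V k = basisT U V l := by
  have h1 : projT U V (basisT U V l) = basisT U V l := projT_projT _ _ _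
  have h2 : ∑ k, (basisT U V l) k • (EuclideanSpace.single k 1 : Frob n₁ n₂) = basisT U V l := by
    have := (EuclideanSpace.basisFun (Fin n₁ × Fin n₂) ℝ).sum_repr (basisT U V l)
    simpa using this
  simp only [inner_basisT, h1]
  conv_rhs => rw [← h1, ← h2, map_sum]
  exact Finset.sum_congr rfl fun k _ => by rw [map_smul]; rfl

lemma norm_basisT_sq_le_one (U : Matrix (Fin n₁) (Fin r) ℝ) (V : Matrix (Fin n₂) (Fin r) ℝ)
    (k : Fin n₁ × Fin n₂) : ‖basisT U V k‖ ^ 2 ≤ 1 := by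
  have : ‖basisT U V k‖ ≤ 1 := by
    refine (Submodule.norm_starProjection_apply_le _ _).trans ?_
    simp
  exact pow_le_one₀ (norm_nonneg _) this

/-- With a and b the two sums on the right, the squared norm is the diagonal entry 1 - (1 - a)(1 -
b) of P_T. -/
lemma norm_basisT_sq_le {U : Matrix (Fin n₁) (Fin r) ℝ} {V : Matrix (Fin n₂) (Fin r) ℝ}
    (hU : U.transpose * U = 1) (hV : V.transpose * V = 1) (k : Fin n₁ × Fin n₂) :
    ‖basisT U V k‖ ^ 2 ≤ ∑ l, U k.1 l ^ 2 + ∑ l, V k.2 l ^ 2 := by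
  obtain ⟨i, j⟩ := k
  have h1 : ‖basisT U V (i, j)‖ ^ 2 = (basisT U V (i, j)) (i, j) := by
    rw [← real_inner_self_eq_norm_sq, inner_basisT, basisT, projT_projT]
  have hs : toMat (EuclideanSpace.single (i, j) 1 : Frob n₁ n₂) = Matrix.single i j 1 := by
    ext a b
    simp [toMat, Matrix.single_apply, Prod.ext_iff, eq_comm]
  have h2 : (basisT U V (i, j)) (i, j) =
      1 - (1 - ∑ l, U i l ^ 2) * (1 - ∑ l, V j l ^ 2) := by
    rw [basisT, projT_eq_sub, projTperp_eq hU hV, hs, PiLp.sub_apply]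
    congr 1
    · simp
    · simp only [ofMat]
      rw [Matrix.mul_apply, Finset.sum_eq_single j]
      · rw [Matrix.mul_single_apply_same]
        simp [Matrix.mul_apply, sq]
      · intro b _ hb
        rw [Matrix.mul_single_apply_of_ne]
        · simp
        · exact hb
      · simp
  have hu : 0 ≤ ∑ l, U i l ^ 2 := Finset.sum_nonneg fun _ _ => sq_nonneg _
  have hv : 0 ≤ ∑ l, V j l ^ 2 := Finset.sum_nonneg fun _ _ => sq_nonneg _
  rw [h1, h2]
  nlinarith

/-- `P_T P_Ω P_T` is the frame operator of the vectors `basisT U V k`, `k ∈ Ω`. -/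
lemma norm_projΩ_comp_projT_le (U : Matrix (Fin n₁) (Fin r) ℝ) (V : Matrix (Fin n₂) (Fin r) ℝ)
    (s : Finset (Fin n₁ × Fin n₂)) {c : ℝ} (hc : 0 ≤ c)
    (h : ∀ x, inner ℝ x (frameOp (basisT U V) s x) ≤ c ^ 2 * ‖x‖ ^ 2) :
    ‖projΩ (↑s : Set (Fin n₁ × Fin n₂)) ∘L projT U V‖ ≤ c := by
  refine ContinuousLinearMap.opNorm_le_bound _ hc fun x => ?_
  have e : ‖projΩ (↑s : Set (Fin n₁ × Fin n₂)) (projT U V x)‖ ^ 2 =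
      inner ℝ x (frameOp (basisT U V) s x) := by
    rw [inner_frameOp, ← real_inner_self_eq_norm_sq, inner_frob]
    simp only [inner_basisT, projΩ_apply, Finset.mem_coe]
    rw [← Finset.sum_filter_add_sum_filter_not Finset.univ (· ∈ s)]
    rw [Finset.filter_mem_eq_inter, Finset.univ_inter]
    rw [Finset.sum_congr rfl fun p hp => by rw [if_pos hp],
      Finset.sum_eq_zero (s := Finset.univ.filter fun p => p ∉ s)
        (fun p hp => by rw [if_neg (Finset.mem_filter.1 hp).2, zero_mul]), add_zero]
  have h2 := h x
  rw [← e, ← mul_pow] at h2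
  exact le_of_pow_le_pow_left₀ two_ne_zero (by positivity) h2

/-- The operator `P_Ω P_T P_Ω`. -/
noncomputable def sandwich (U : Matrix (Fin n₁) (Fin r) ℝ) (V : Matrix (Fin n₂) (Fin r) ℝ)
    (Ω : Set (Fin n₁ × Fin n₂)) : Frob n₁ n₂ →L[ℝ] Frob n₁ n₂ :=
  projΩ Ω ∘L projT U V ∘L projΩ Ω

/-- `(1 - P_Ω P_T P_Ω)⁻¹ Z`. -/
noncomputable def resolvent (U : Matrix (Fin n₁) (Fin r) ℝ) (V : Matrix (Fin n₂) (Fin r) ℝ)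
    (Ω : Set (Fin n₁ × Fin n₂)) (Z : Frob n₁ n₂) : Frob n₁ n₂ :=
  (Ring.inverse (1 - sandwich U V Ω)) Z

variable {U : Matrix (Fin n₁) (Fin r) ℝ} {V : Matrix (Fin n₂) (Fin r) ℝ}
  {Ω : Set (Fin n₁ × Fin n₂)} {σ : ℝ}

lemma norm_sandwich_le (h : ‖projΩ Ω ∘L projT U V‖ ≤ σ) : ‖sandwich U V Ω‖ ≤ σ := by
  have e : sandwich U V Ω = (projΩ Ω ∘L projT U V) ∘L projΩ Ω := rfl
  rw [e]
  calc _ ≤ ‖projΩ Ω ∘L projT U V‖ * ‖projΩ Ω‖ := ContinuousLinearMap.opNorm_comp_le _ _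
    _ ≤ ‖projΩ Ω ∘L projT U V‖ * 1 := by
        gcongr
        exact Submodule.starProjection_norm_le _
    _ ≤ σ := by rwa [mul_one]

lemma resolvent_sub (hσ : σ < 1) (h : ‖projΩ Ω ∘L projT U V‖ ≤ σ) (Z : Frob n₁ n₂) :
    resolvent U V Ω Z - sandwich U V Ω (resolvent U V Ω Z) = Z := by
  have hu : IsUnit (1 - sandwich U V Ω) :=
    isUnit_one_sub_of_norm_lt_one ((norm_sandwich_le h).trans_lt hσ)
  have := congrArg (fun f : Frob n₁ n₂ →L[ℝ] Frob n₁ n₂ => f Z) (Ring.mul_inverse_cancel _ hu)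
  simpa [resolvent] using this

lemma norm_resolvent_le (hσ : σ < 1) (h : ‖projΩ Ω ∘L projT U V‖ ≤ σ) (Z : Frob n₁ n₂) :
    ‖resolvent U V Ω Z‖ ≤ ‖Z‖ / (1 - σ) := by
  have h1 := resolvent_sub hσ h Z
  set X := resolvent U V Ω Z
  have h2 : ‖sandwich U V Ω X‖ ≤ σ * ‖X‖ :=
    (ContinuousLinearMap.le_opNorm _ _).trans
      (mul_le_mul_of_nonneg_right (norm_sandwich_le h) (norm_nonneg _))
  have h3 : ‖X‖ - ‖sandwich U V Ω X‖ ≤ ‖Z‖ := by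
    rw [← h1]
    exact norm_sub_norm_le _ _
  rw [le_div_iff₀ (by linarith)]
  linarith

lemma norm_resolvent_sub_le (hσ : σ < 1) (h : ‖projΩ Ω ∘L projT U V‖ ≤ σ) (Z : Frob n₁ n₂) :
    ‖resolvent U V Ω Z - Z‖ ≤ σ * (‖Z‖ / (1 - σ)) := by
  have h1 := resolvent_sub hσ h Z
  have h2 := norm_resolvent_le hσ h Z
  have e : resolvent U V Ω Z - Z = sandwich U V Ω (resolvent U V Ω Z) := by
    rw [sub_eq_iff_eq_add, ← sub_eq_iff_eq_add', h1]
  rw [e]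
  have hσ0 : 0 ≤ σ := (norm_nonneg _).trans h
  exact (ContinuousLinearMap.le_opNorm _ _).trans
    (mul_le_mul (norm_sandwich_le h) h2 (norm_nonneg _) hσ0)

/-- Self-adjointness moves the inverse from the random right-hand side to the test matrix `Z`,
leaving coefficients that depend on `Ω` but not on the signs. -/
lemma inner_resolvent (hσ : σ < 1) (h : ‖projΩ Ω ∘L projT U V‖ ≤ σ) (Z Y : Frob n₁ n₂) :
    inner ℝ Z Y = inner ℝ (resolvent U V Ω Z) (Y - sandwich U V Ω Y) := by
  have hs : inner ℝ (sandwich U V Ω (resolvent U V Ω Z)) Y =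
      inner ℝ (resolvent U V Ω Z) (sandwich U V Ω Y) := by
    simp only [sandwich, ContinuousLinearMap.comp_apply]
    rw [inner_projΩ_left, inner_projT_left, inner_projΩ_left]
  nth_rw 1 [← resolvent_sub hσ h Z]
  rw [inner_sub_left, inner_sub_right, hs]

/-- In finite dimension injectivity suffices, and a kernel element is fixed by an operator of norm
less than 1. -/
lemma isUnit_normalOp (hσ : σ < 1) (h : ‖projΩ Ω ∘L projT U V‖ ≤ σ) :
    IsUnit (normalOp U V Ω) := by
  rw [LinearMap.isUnit_iff_ker_eq_bot, LinearMap.ker_eq_bot']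
  rintro ⟨Y, hY⟩ h0
  have hYΩ : projΩ Ω Y = Y := Submodule.starProjection_eq_self_iff.2 hY
  have h1 : Y - sandwich U V Ω Y = 0 := by
    have := congrArg Subtype.val h0
    simp only [normalOp, LinearMap.restrict_apply] at this
    simpa [sandwich, hYΩ] using this
  have h2 : ‖Y‖ ≤ σ * ‖Y‖ := by
    nth_rw 1 [sub_eq_zero.1 h1]
    exact (ContinuousLinearMap.le_opNorm _ _).trans
      (mul_le_mul_of_nonneg_right (norm_sandwich_le h) (norm_nonneg _))
  have h3 : ‖Y‖ = 0 := by nlinarith [norm_nonneg Y]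
  exact Subtype.ext (norm_eq_zero.1 h3)

/-- The certificate is `lam • P_{T⊥} Y` for the solution `Y` of `Y - P_Ω P_T P_Ω Y = sgn S`. -/
lemma exists_WS_eq (S : Matrix (Fin n₁) (Fin n₂) ℝ) (hu : IsUnit (normalOp U V (supp S)))
    (lam : ℝ) :
    ∃ Y : Frob n₁ n₂, Y ∈ supportedOn (supp S) ∧ WS lam U V S = lam • projTperp U V Y ∧
      Y - sandwich U V (supp S) Y = ofMat (S.map Real.sign) := by
  set Y := Ring.inverse (normalOp U V (supp S)) (sgn S) with hYdef
  refine ⟨Y, Y.2, rfl, ?_⟩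
  have h1 : normalOp U V (supp S) Y = sgn S := by
    have := congrArg (fun f : Module.End ℝ (supportedOn (supp S)) => f (sgn S))
      (Ring.mul_inverse_cancel _ hu)
    simpa [hYdef] using this
  have hYΩ : projΩ (supp S) (Y : Frob n₁ n₂) = Y := Submodule.starProjection_eq_self_iff.2 Y.2
  have := congrArg Subtype.val h1
  simp only [normalOp, LinearMap.restrict_apply] at this
  simpa [sandwich, hYΩ, sgn] using this

end Deterministic

end RobustPCA

namespace RobustPCA

/-! ### From the random matrix to the finite law of sign patterns. -/

section Transfer

/-- The sign pattern of a matrix. -/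
noncomputable def pattern {n₁ n₂ : ℕ} (S : Matrix (Fin n₁) (Fin n₂) ℝ) :
    Fin n₁ × Fin n₂ → SignType :=
  fun p => SignType.sign (S p.1 p.2)

lemma real_sign_eq (x : ℝ) : Real.sign x = (SignType.sign x : ℝ) := by
  rcases lt_trichotomy x 0 with h | h | h
  · rw [Real.sign_of_neg h, sign_neg h]; simp
  · simp [h]
  · rw [Real.sign_of_pos h, sign_pos h]; simp

lemma coe_patSupp_pattern {n₁ n₂ : ℕ} (S : Matrix (Fin n₁) (Fin n₂) ℝ) :
    (↑(patSupp (pattern S)) : Set (Fin n₁ × Fin n₂)) = supp S := by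
  ext p
  simp [patSupp, pattern, supp]

open Classical in
/-- The probability of an event under the law `patWeight ρ`. -/
noncomputable def patProb {ι : Type*} [Fintype ι] [DecidableEq ι] (ρ : ℝ)
    (B : (ι → SignType) → Prop) : ℝ :=
  ∑ e with B e, patWeight ρ e

variable {ι : Type*} [Fintype ι] [DecidableEq ι] {ρ : ℝ}

lemma patProb_or_le (h0 : 0 ≤ ρ) (h1 : ρ ≤ 1) (B C : (ι → SignType) → Prop) :
    patProb ρ (fun e => B e ∨ C e) ≤ patProb ρ B + patProb ρ C := by
  classical
  unfold patProb
  simp only [Finset.sum_filter, ← Finset.sum_add_distrib]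
  refine Finset.sum_le_sum fun e _ => ?_
  have := patWeight_nonneg h0 h1 e
  by_cases hB : B e <;> by_cases hC : C e <;> simp [hB, hC, this]

lemma patProb_exists_le {α : Type*} (h0 : 0 ≤ ρ) (h1 : ρ ≤ 1) (s : Finset α)
    (B : α → (ι → SignType) → Prop) {c : ℝ} (hc : ∀ x ∈ s, patProb ρ (B x) ≤ c) :
    patProb ρ (fun e => ∃ x ∈ s, B x e) ≤ s.card * c := by
  classical
  induction s using Finset.induction_on with
  | empty => simp [patProb]
  | insert a s ha ih =>
    have e1 : (fun e => ∃ x ∈ insert a s, B x e) = fun e => B a e ∨ ∃ x ∈ s, B x e := by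
      funext e
      simp
    rw [e1, Finset.card_insert_of_notMem ha]
    refine (patProb_or_le h0 h1 _ _).trans ?_
    have := ih fun x hx => hc x (Finset.mem_insert_of_mem hx)
    have := hc a (Finset.mem_insert_self a s)
    push_cast
    linarith

variable {n₁ n₂ : ℕ} {X : Type*} [MeasurableSpace X] {P : Measure X} [IsProbabilityMeasure P]
  {S : X → Matrix (Fin n₁) (Fin n₂) ℝ}

lemma BernoulliRandomSigns.real_supp_eq (h : BernoulliRandomSigns P ρ S)
    (Ω : Finset (Fin n₁ × Fin n₂)) :
    P.real {x | supp (S x) = ↑Ω} = ∏ p, if p ∈ Ω then ρ else 1 - ρ := by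
  classical
  have hmeas : ∀ p : Fin n₁ × Fin n₂, MeasurableSet {x | p ∈ supp (S x)} := fun p =>
    (h.measurable p.1 p.2) (measurableSet_singleton (0 : ℝ)).compl
  set f : Fin n₁ × Fin n₂ → Set X := fun p =>
    if p ∈ Ω then {x | p ∈ supp (S x)} else {x | p ∈ supp (S x)}ᶜ with hf
  have e1 : {x | supp (S x) = ↑Ω} = ⋂ p, f p := by
    ext x
    simp only [Set.mem_ofPred_eq, Set.mem_iInter, Set.ext_iff, hf]
    refine forall_congr' fun p => ?_
    by_cases hp : p ∈ Ω <;> simp [hp]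
  have hind := (iIndepSet_iff _ _).1 h.indep Finset.univ (f := f) (by
    intro p _
    have hb : MeasurableSet[MeasurableSpace.generateFrom {{x | p ∈ supp (S x)}}]
        {x | p ∈ supp (S x)} := MeasurableSpace.measurableSet_generateFrom rfl
    simp only [hf]
    split_ifs
    · exact hb
    · exact hb.compl)
  have e2 : ⋂ p ∈ (Finset.univ : Finset (Fin n₁ × Fin n₂)), f p = ⋂ p, f p := by simp
  rw [e2] at hind
  rw [e1, Measure.real, hind, ENNReal.toReal_prod]
  refine Finset.prod_congr rfl fun p _ => ?_
  simp only [hf]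
  split_ifs
  · exact h.prob p
  · have := probReal_compl_eq_one_sub (μ := P) (hmeas p)
    rw [h.prob p] at this
    exact this

/-- Each support entry contributes ρ from the support law and 1/2 from the uniform signs; every
other entry contributes 1 - ρ. -/
lemma BernoulliRandomSigns.real_pattern_eq (h : BernoulliRandomSigns P ρ S)
    (e : Fin n₁ × Fin n₂ → SignType) : P.real {x | pattern (S x) = e} = patWeight ρ e := by
  classical
  -- `signs` demands a value ±1 everywhere; the value 1 off the support is arbitrary.
  have hs := h.signs (patSupp e) (fun p => if e p = -1 then -1 else 1) (fun p => by
    split_ifs <;> simp)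
  have e1 : {x | pattern (S x) = e} = {x | supp (S x) = ↑(patSupp e) ∧
      ∀ p ∈ patSupp e, Real.sign (S x p.1 p.2) = if e p = -1 then -1 else 1} := by
    ext x
    simp only [Set.mem_ofPred_eq]
    constructor
    · intro hx
      refine ⟨by rw [← coe_patSupp_pattern, hx], fun p hp => ?_⟩
      have hp0 : e p ≠ 0 := by simpa [patSupp] using hp
      rw [real_sign_eq]
      have : SignType.sign (S x p.1 p.2) = e p := congrFun hx p
      rw [this]
      generalize e p = a at hp0
      cases a <;> simp at hp0 ⊢
    · rintro ⟨hx1, hx2⟩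
      funext p
      by_cases hp : p ∈ patSupp e
      · have hp0 : e p ≠ 0 := by simpa [patSupp] using hp
        have := hx2 p hp
        rw [real_sign_eq] at this
        change SignType.sign (S x p.1 p.2) = e p
        generalize SignType.sign (S x p.1 p.2) = b at this
        generalize e p = a at this hp0
        cases a <;> cases b <;> simp at hp0 this ⊢ <;> norm_num at this
      · have hp0 : e p = 0 := by simpa [patSupp] using hp
        have hq : p ∉ supp (S x) := by rw [hx1]; exact hp
        have : S x p.1 p.2 = 0 := by simpa [supp] using hq
        simp [pattern, this, hp0]
  rw [e1, hs, h.real_supp_eq, ← Finset.prod_const, patWeight]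
  rw [← Finset.prod_filter_mul_prod_filter_not Finset.univ (· ∈ patSupp e),
    ← Finset.prod_filter_mul_prod_filter_not (f := fun p => signWeight ρ (e p))
      Finset.univ (· ∈ patSupp e)]
  rw [mul_right_comm]
  congr 1
  · rw [Finset.filter_mem_eq_inter, Finset.univ_inter, ← Finset.prod_mul_distrib]
    refine Finset.prod_congr rfl fun p hp => ?_
    have hp0 : e p ≠ 0 := by simpa [patSupp] using hp
    simp [hp, signWeight, hp0]
    ring
  · refine Finset.prod_congr rfl fun p hp => ?_
    have hp := (Finset.mem_filter.1 hp).2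
    have hp0 : e p = 0 := by simpa [patSupp] using hp
    rw [if_neg hp]
    simp [signWeight, hp0]

/-- An event that contains the complement of an event on sign patterns. -/
lemma BernoulliRandomSigns.one_sub_patProb_le (h : BernoulliRandomSigns P ρ S)
    (B : (Fin n₁ × Fin n₂ → SignType) → Prop) (A : Set X)
    (hA : ∀ x, ¬ B (pattern (S x)) → x ∈ A) : 1 - patProb ρ B ≤ P.real A := by
  classical
  -- Covering the space and using subadditivity requires no measurability of `A`.
  have h1 : P.real (A ∪ ⋃ e ∈ Finset.univ.filter B, {x | pattern (S x) = e}) = 1 := by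
    have : A ∪ ⋃ e ∈ Finset.univ.filter B, {x | pattern (S x) = e} = Set.univ := by
      ext x
      simp only [Set.mem_union, Set.mem_iUnion, Set.mem_univ, iff_true]
      by_cases hx : B (pattern (S x))
      · exact Or.inr ⟨_, Finset.mem_filter.2 ⟨Finset.mem_univ _, hx⟩, rfl⟩
      · exact Or.inl (hA x hx)
    rw [this]
    exact probReal_univ
  have h2 := measureReal_union_le (μ := P) A (⋃ e ∈ Finset.univ.filter B, {x | pattern (S x) = e})
  have h3 := measureReal_biUnion_finset_le (μ := P) (Finset.univ.filter B)
    fun e => {x | pattern (S x) = e}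
  simp only [h.real_pattern_eq] at h3
  have h4 : ∑ e ∈ Finset.univ.filter B, patWeight ρ e = patProb ρ B := by
    unfold patProb
    congr
  linarith

end Transfer

end RobustPCA

namespace RobustPCA

/-! ### Deterministic sufficient conditions for the certificate. -/

section Certificate

variable {n₁ n₂ r : ℕ} {U : Matrix (Fin n₁) (Fin r) ℝ} {V : Matrix (Fin n₂) (Fin r) ℝ}

/-- The rank-one matrix `y xᵀ`. -/
noncomputable def outer (y : EuclideanSpace ℝ (Fin n₁)) (x : EuclideanSpace ℝ (Fin n₂)) :
    Frob n₁ n₂ :=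
  WithLp.toLp 2 fun p => y p.1 * x p.2

lemma sum_sq_eq_norm_sq {ι : Type*} [Fintype ι] (Z : EuclideanSpace ℝ ι) :
    ∑ p, Z p ^ 2 = ‖Z‖ ^ 2 := by
  rw [EuclideanSpace.norm_sq_eq]
  simp

lemma norm_outer (y : EuclideanSpace ℝ (Fin n₁)) (x : EuclideanSpace ℝ (Fin n₂)) :
    ‖outer y x‖ = ‖y‖ * ‖x‖ := by
  have h : ‖outer y x‖ ^ 2 = (‖y‖ * ‖x‖) ^ 2 := by
    rw [← sum_sq_eq_norm_sq, mul_pow, ← sum_sq_eq_norm_sq y, ← sum_sq_eq_norm_sq x,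
      Finset.sum_mul_sum, Fintype.sum_prod_type]
    simp [outer, mul_pow]
  exact (sq_eq_sq₀ (norm_nonneg _) (by positivity)).1 h

lemma inner_toEuclideanLin (M : Matrix (Fin n₁) (Fin n₂) ℝ) (y : EuclideanSpace ℝ (Fin n₁))
    (x : EuclideanSpace ℝ (Fin n₂)) :
    inner ℝ y (Matrix.toEuclideanLin M x) = inner ℝ (outer y x) (ofMat M) := by
  rw [inner_frob, Fintype.sum_prod_type, PiLp.inner_apply]
  refine Finset.sum_congr rfl fun i _ => ?_
  simp [outer, ofMat, Matrix.toLpLin_apply, Matrix.mulVec, dotProduct, Finset.sum_mul]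
  exact Finset.sum_congr rfl fun j _ => by ring

/-- The deterministic conditions under which the certificate has the required properties. -/
lemma certificate_of_bounds (hU : U.transpose * U = 1) (hV : V.transpose * V = 1)
    (S : Matrix (Fin n₁) (Fin n₂) ℝ) {σ n lam : ℝ} (hσ : σ < 1 / 2) (hn : 0 < n)
    (hlam : lam = 1 / Real.sqrt n)
    (hΩ : ‖projΩ (supp S) ∘L projT U V‖ ≤ σ)
    (sx : Finset (EuclideanSpace ℝ (Fin n₂))) (sy : Finset (EuclideanSpace ℝ (Fin n₁)))
    (hsx : ∀ x, ‖x‖ ≤ 1 → ∃ y ∈ sx, ‖x - y‖ ≤ 1 / 2)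
    (hsy : ∀ x, ‖x‖ ≤ 1 → ∃ y ∈ sy, ‖x - y‖ ≤ 1 / 2)
    (h₁ : ∀ x ∈ sx, ∀ y ∈ sy,
      inner ℝ (outer y x) (ofMat (S.map Real.sign)) ≤ Real.sqrt n / 40)
    (h₂ : ∀ x ∈ sx, ∀ y ∈ sy, inner ℝ (resolvent U V (supp S) (outer y x) - outer y x)
      (ofMat (S.map Real.sign)) ≤ Real.sqrt n / 40)
    (h₃ : ∀ k, |inner ℝ (resolvent U V (supp S) (basisT U V k)) (ofMat (S.map Real.sign))| < 1 / 4) :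
    WSDefined U V S ∧ opNorm (toMat (WS lam U V S)) < 1 / 4 ∧
      maxNorm (toMat (projΩ (supp S)ᶜ (WS lam U V S))) < lam / 4 := by
  classical
  have hσ1 : σ < 1 := by linarith
  have hu := isUnit_normalOp hσ1 hΩ
  obtain ⟨Y, hY, hWS, hYE⟩ := exists_WS_eq S hu lam
  have hsn : 0 < Real.sqrt n := Real.sqrt_pos.2 hn
  have hlam0 : 0 < lam := by rw [hlam]; positivity
  refine ⟨⟨hΩ.trans_lt hσ, hu⟩, ?_, ?_⟩
  -- The nets cost a factor 4, so ‖Y‖ ≤ √n/5 and λ‖Y‖ ≤ 1/5, below 1/4.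
  · have hYn : opNorm (toMat Y) ≤ 4 * (Real.sqrt n / 40 + Real.sqrt n / 40) := by
      refine norm_le_of_half_nets _ (sx : Set _) (sy : Set _) hsx hsy (by positivity)
        fun x hx y hy => ?_
      have e : inner ℝ y (Matrix.toEuclideanLin (toMat Y) x) =
          inner ℝ (outer y x) (ofMat (S.map Real.sign)) +
          inner ℝ (resolvent U V (supp S) (outer y x) - outer y x) (ofMat (S.map Real.sign)) := by
        rw [inner_toEuclideanLin, ofMat_toMat, inner_resolvent hσ1 hΩ, hYE, ← inner_add_left]
        congr 1
        abel
      exact e.le.trans (add_le_add (h₁ x hx y hy) (h₂ x hx y hy))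
    have e1 : opNorm (toMat (WS lam U V S)) = lam * opNorm (toMat (projTperp U V Y)) := by
      have : toMat (WS lam U V S) = lam • toMat (projTperp U V Y) := by rw [hWS]; rfl
      rw [this, opNorm, opNorm, map_smul, map_smul, norm_smul, Real.norm_of_nonneg hlam0.le]
    rw [e1]
    calc _ ≤ lam * (4 * (Real.sqrt n / 40 + Real.sqrt n / 40)) := by
          gcongr
          exact (opNorm_projTperp_le hU hV Y).trans hYn
      _ = 1 / 5 := by rw [hlam]; field_simp; norm_num
      _ < 1 / 4 := by norm_num
  · unfold maxNorm
    rw [pi_norm_lt_iff (by positivity)]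
    intro k
    change ‖projΩ (supp S)ᶜ (WS lam U V S) k‖ < lam / 4
    rw [projΩ_apply]
    split_ifs with hk
    · have hYk : Y k = 0 := hY k hk
      -- Since `Y k = 0`, the entry of P_{T⊥} Y equals minus that of P_T Y, to which duality
      -- applies.
      have e : WS lam U V S k =
          -(lam * inner ℝ (resolvent U V (supp S) (basisT U V k)) (ofMat (S.map Real.sign))) := by
        rw [← hYE, ← inner_resolvent hσ1 hΩ, inner_basisT, projT_eq_sub, PiLp.sub_apply, hYk, hWS,
          PiLp.smul_apply, smul_eq_mul]
        ring
      rw [e, norm_neg, norm_mul, Real.norm_of_nonneg hlam0.le, Real.norm_eq_abs]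
      have := h₃ k
      calc _ < lam * (1 / 4) := by gcongr
        _ = lam / 4 := by ring
    · rw [norm_zero]
      positivity

end Certificate

/-! ### Tail bounds for inner products with the sign matrix. -/

section Union

variable {ι : Type*} [Fintype ι] [DecidableEq ι]

/-- A sign pattern as a vector. -/
noncomputable def patVec (e : ι → SignType) : EuclideanSpace ℝ ι :=
  WithLp.toLp 2 fun p => (e p : ℝ)

lemma ofMat_map_sign {n₁ n₂ : ℕ} (S : Matrix (Fin n₁) (Fin n₂) ℝ) :
    ofMat (S.map Real.sign) = patVec (pattern S) := by
  ext p
  exact real_sign_eq _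

omit [DecidableEq ι] in
lemma inner_patVec (Z : EuclideanSpace ℝ ι) (e : ι → SignType) :
    inner ℝ Z (patVec e) = ∑ p, Z p * (e p : ℝ) := by
  rw [PiLp.inner_apply]
  exact Finset.sum_congr rfl fun p _ => by simp [patVec, mul_comm]

omit [DecidableEq ι] in
lemma patSupp_flipSigns (b : ι → Bool) (e : ι → SignType) :
    patSupp (flipSigns b e) = patSupp e := by
  ext p
  have : flipSigns b e p = 0 ↔ e p = 0 := by
    unfold flipSigns
    split_ifs
    · cases e p <;> decide
    · rfl
  simp [patSupp, this]

lemma patProb_linear_le {ρ κ : ℝ} (hκ : 0 < κ) (h0 : 0 ≤ ρ) (h1 : ρ ≤ 1)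
    (h : ρ ≤ κ * Real.exp (-(2 / κ ^ 2))) (Z : EuclideanSpace ℝ ι) (hZ : ‖Z‖ ≤ 1) {t : ℝ}
    (ht : 0 ≤ t) :
    patProb ρ (fun e => t ≤ inner ℝ Z (patVec e)) ≤ Real.exp (-(t ^ 2 / (2 * κ))) := by
  have hZ2 : ∑ p, Z p ^ 2 ≤ 1 := by
    rw [sum_sq_eq_norm_sq]
    exact pow_le_one₀ (norm_nonneg _) hZ
  have := sum_patWeight_le_exp_of_linear hκ h0 h1 h (fun p => Z p) hZ2 ht
  unfold patProb
  simp only [inner_patVec]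
  convert this

lemma patProb_support_le {ρ v t : ℝ} (h0 : 0 ≤ ρ) (h1 : ρ ≤ 1) (hv : 0 < v) (ht : 0 ≤ t)
    (G : Finset ι → Prop) (Z : Finset ι → EuclideanSpace ℝ ι) (hZ : ∀ s, G s → ‖Z s‖ ^ 2 ≤ v) :
    patProb ρ (fun e => G (patSupp e) ∧ t ≤ inner ℝ (Z (patSupp e)) (patVec e)) ≤
      Real.exp (-(t ^ 2 / (2 * v))) := by
  classical
  have := sum_patWeight_le_exp_of_support h0 h1 hv ht (fun e : ι → SignType => G (patSupp e))
    (fun e p => Z (patSupp e) p) (fun b e => by rw [patSupp_flipSigns])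
    (fun b e => by simp only [patSupp_flipSigns])
    (fun e he => by rw [sum_sq_eq_norm_sq]; exact hZ _ he)
  unfold patProb
  simp only [inner_patVec]
  convert this

end Union

end RobustPCA

namespace RobustPCA

/-! ### Numerical estimates. -/

section Numerics

lemma exp_neg_mul_log {n : ℝ} (hn : 0 < n) : Real.exp (-(12 * Real.log n)) = 1 / n ^ 12 := by
  rw [Real.exp_neg, mul_comm, Real.exp_mul, Real.exp_log hn]
  norm_cast
  rw [one_div]

lemma twentyFive_pow_mul_exp_le {n : ℕ} (hn : 0 < n) :
    (25 : ℝ) ^ n * Real.exp (-(14 * n)) ≤ 1 / (n : ℝ) ^ 10 := by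
  have hn' : (0 : ℝ) < n := by exact_mod_cast hn
  have h25 : (25 : ℝ) ≤ Real.exp 4 := by
    have h1 : (2.7 : ℝ) ≤ Real.exp 1 := by linarith [Real.exp_one_gt_d9]
    have h2 : Real.exp 4 = Real.exp 1 ^ 4 := by rw [← Real.exp_nat_mul]; norm_num
    rw [h2]
    calc (25 : ℝ) ≤ 2.7 ^ 4 := by norm_num
      _ ≤ _ := by gcongr
  have hexp : Real.exp (-(n : ℝ)) ≤ 1 / n := by
    rw [Real.exp_neg, one_div]
    apply inv_anti₀ hn'
    linarith [Real.add_one_le_exp (n : ℝ)]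
  calc (25 : ℝ) ^ n * Real.exp (-(14 * n)) ≤ Real.exp 4 ^ n * Real.exp (-(14 * n)) := by gcongr
    _ = Real.exp (-(n : ℝ)) ^ 10 := by
        rw [← Real.exp_nat_mul, ← Real.exp_nat_mul, ← Real.exp_add]
        congr 1
        push_cast
        ring
    _ ≤ (1 / n) ^ 10 := by gcongr
    _ = _ := by rw [div_pow, one_pow]

end Numerics

/-! ### Probabilities of the bad events. -/

section Probability

variable {n₁ n₂ r : ℕ} {U : Matrix (Fin n₁) (Fin r) ℝ} {V : Matrix (Fin n₂) (Fin r) ℝ}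

lemma card_index_le (n₁ n₂ : ℕ) :
    (Fintype.card (Fin n₁ × Fin n₂) : ℝ) ≤ ((max n₁ n₂ : ℕ) : ℝ) ^ 2 := by
  rw [Fintype.card_prod, Fintype.card_fin, Fintype.card_fin, sq]
  exact_mod_cast Nat.mul_le_mul (le_max_left _ _) (le_max_right _ _)

/-- `‖P_Ω P_T‖` is small with high probability. -/
lemma patProb_frameMoment_le {ρ : ℝ} (h0 : 0 ≤ ρ) (h1 : ρ ≤ 1 / 10 ^ 7)
    (hn : 1 ≤ Real.log (max n₁ n₂ : ℕ))
    (hR : ∀ k, ‖basisT U V k‖ ^ 2 ≤ 2 / 10 ^ 9 / Real.log (max n₁ n₂ : ℕ) ^ 2) :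
    patProb ρ (fun e => ((1 / 1000 : ℝ) ^ 2) ^ (⌊12 * Real.log (max n₁ n₂ : ℕ)⌋₊ + 1) ≤
      frameMoment (basisT U V) ⌊12 * Real.log (max n₁ n₂ : ℕ)⌋₊ (patSupp e)) ≤
      1 / ((max n₁ n₂ : ℕ) : ℝ) ^ 10 := by
  set n : ℝ := ((max n₁ n₂ : ℕ) : ℝ) with hndef
  set ℓ := Real.log n with hℓ
  -- With ratio at most e⁻¹, more than 12 log n powers give n⁻¹²; the factor n² from the number of
  -- entries leaves n⁻¹⁰.
  set J := ⌊12 * ℓ⌋₊ with hJ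
  have hn0 : 0 < n := by
    have hn0 : 0 ≤ n := Nat.cast_nonneg _
    rcases hn0.eq_or_lt with h | h
    · rw [hℓ, ← h, Real.log_zero] at hn
      linarith
    · exact h
  have key := sum_patWeight_frameMoment_ge_le (c := (1 / 1000 : ℝ) ^ 2) h0 (by linarith)
    (basisT U V) (sum_inner_basisT_smul U V) (by positivity) hR (norm_basisT_sq_le_one U V) J
    (by norm_num)
  have hJle : (J : ℝ) ≤ 12 * ℓ := Nat.floor_le (by linarith)
  have hJlt : 12 * ℓ < J + 1 := Nat.lt_floor_add_one _
  have hb : (ρ + J * (2 / 10 ^ 9 / ℓ ^ 2)) / (1 / 1000 : ℝ) ^ 2 ≤ Real.exp (-1) := by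
    have e1 : (J : ℝ) * (2 / 10 ^ 9 / ℓ ^ 2) ≤ 24 / 10 ^ 9 := by
      calc (J : ℝ) * (2 / 10 ^ 9 / ℓ ^ 2) ≤ 12 * ℓ * (2 / 10 ^ 9 / ℓ ^ 2) := by gcongr
        _ = 24 / 10 ^ 9 / ℓ := by field_simp; norm_num
        _ ≤ 24 / 10 ^ 9 := div_le_self (by norm_num) hn
    have e2 : (1 / 3 : ℝ) ≤ Real.exp (-1) := by
      rw [Real.exp_neg, one_div]
      exact inv_anti₀ (Real.exp_pos _) (by linarith [Real.exp_one_lt_d9])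
    calc _ ≤ (1 / 10 ^ 7 + 24 / 10 ^ 9) / (1 / 1000 : ℝ) ^ 2 := by gcongr
      _ ≤ 1 / 3 := by norm_num
      _ ≤ _ := e2
  have hpow : ((ρ + J * (2 / 10 ^ 9 / ℓ ^ 2)) / (1 / 1000 : ℝ) ^ 2) ^ (J + 1) ≤ 1 / n ^ 12 := by
    rw [← exp_neg_mul_log hn0]
    calc _ ≤ Real.exp (-1) ^ (J + 1) := by gcongr
      _ = Real.exp (-(J + 1 : ℝ)) := by
          rw [← Real.exp_nat_mul]
          push_cast
          congr 1
          ring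
      _ ≤ _ := Real.exp_le_exp.2 (by linarith)
  calc _ = _ := by unfold patProb; congr
    _ ≤ _ := key
    _ ≤ n ^ 2 * (1 / n ^ 12) := by
        gcongr
        exact card_index_le n₁ n₂
    _ = _ := by field_simp

/-- A bad sign pattern. -/
def BadPattern (U : Matrix (Fin n₁) (Fin r) ℝ) (V : Matrix (Fin n₂) (Fin r) ℝ)
    (G : Finset (Fin n₁ × Fin n₂) → Prop)
    (sx : Finset (EuclideanSpace ℝ (Fin n₂))) (sy : Finset (EuclideanSpace ℝ (Fin n₁))) (n : ℝ)
    (e : Fin n₁ × Fin n₂ → SignType) : Prop :=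
  ¬ G (patSupp e) ∨
  (∃ q ∈ sx ×ˢ sy, Real.sqrt n / 40 ≤ inner ℝ (outer q.2 q.1) (patVec e)) ∨
  (∃ q ∈ sx ×ˢ sy, G (patSupp e) ∧ Real.sqrt n / 40 ≤
    inner ℝ (resolvent U V ↑(patSupp e) (outer q.2 q.1) - outer q.2 q.1) (patVec e)) ∨
  (∃ k ∈ Finset.univ, G (patSupp e) ∧ 1 / 4 ≤
    inner ℝ (resolvent U V ↑(patSupp e) (basisT U V k)) (patVec e)) ∨
  (∃ k ∈ Finset.univ, G (patSupp e) ∧ 1 / 4 ≤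
    inner ℝ (-resolvent U V ↑(patSupp e) (basisT U V k)) (patVec e))

/-- `G` is a condition on the support alone that secures the resolvent bounds. The last two clauses
of `BadPattern` are the two one-sided halves of an absolute value. -/
lemma certificate_of_not_badPattern (hU : U.transpose * U = 1) (hV : V.transpose * V = 1)
    (S : Matrix (Fin n₁) (Fin n₂) ℝ) {G : Finset (Fin n₁ × Fin n₂) → Prop} {σ n lam : ℝ}
    (hσ : σ < 1 / 2) (hn : 0 < n) (hlam : lam = 1 / Real.sqrt n)
    (hG : ∀ s, G s → ‖projΩ (↑s : Set (Fin n₁ × Fin n₂)) ∘L projT U V‖ ≤ σ)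
    (sx : Finset (EuclideanSpace ℝ (Fin n₂))) (sy : Finset (EuclideanSpace ℝ (Fin n₁)))
    (hsx : ∀ x, ‖x‖ ≤ 1 → ∃ y ∈ sx, ‖x - y‖ ≤ 1 / 2)
    (hsy : ∀ x, ‖x‖ ≤ 1 → ∃ y ∈ sy, ‖x - y‖ ≤ 1 / 2)
    (h : ¬ BadPattern U V G sx sy n (pattern S)) :
    WSDefined U V S ∧ opNorm (toMat (WS lam U V S)) < 1 / 4 ∧
      maxNorm (toMat (projΩ (supp S)ᶜ (WS lam U V S))) < lam / 4 := by
  unfold BadPattern at h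
  push Not at h
  rw [← ofMat_map_sign, coe_patSupp_pattern] at h
  obtain ⟨hg, h1, h2, h3, h4⟩ := h
  refine certificate_of_bounds hU hV S hσ hn hlam ?_ sx sy hsx hsy
    (fun x hx y hy => (h1 (x, y) (Finset.mk_mem_product hx hy)).le)
    (fun x hx y hy => (h2 (x, y) (Finset.mk_mem_product hx hy) hg).le) fun k => ?_
  · rw [← coe_patSupp_pattern]
    exact hG _ hg
  · have h5 := h3 k (Finset.mem_univ k) hg
    have h6 := h4 k (Finset.mem_univ k) hg
    rw [inner_neg_left] at h6
    rw [abs_lt]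
    constructor <;> linarith

/-- Each of the five clauses has probability at most n⁻¹⁰: the first by hypothesis, the second by
the small-ρ tail, the others by the Rademacher tail given the support. -/
lemma patProb_badPattern_le {ρ : ℝ} (h0 : 0 ≤ ρ) (h1 : ρ ≤ 1 / 10 ^ 7)
    (hρ : ρ ≤ 1 / 44800 * Real.exp (-(2 / (1 / 44800) ^ 2)))
    (hn : 1 ≤ Real.log (max n₁ n₂ : ℕ))
    (hR : ∀ k, ‖basisT U V k‖ ^ 2 ≤ 2 / 10 ^ 9 / Real.log (max n₁ n₂ : ℕ) ^ 2)
    {G : Finset (Fin n₁ × Fin n₂) → Prop}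
    (hG : ∀ s, G s → ‖projΩ (↑s : Set (Fin n₁ × Fin n₂)) ∘L projT U V‖ ≤ 1 / 1000)
    (hGprob : patProb ρ (fun e => ¬ G (patSupp e)) ≤ 1 / ((max n₁ n₂ : ℕ) : ℝ) ^ 10)
    (sx : Finset (EuclideanSpace ℝ (Fin n₂))) (sy : Finset (EuclideanSpace ℝ (Fin n₁)))
    (hsx1 : ∀ x ∈ sx, ‖x‖ ≤ 1) (hsy1 : ∀ x ∈ sy, ‖x‖ ≤ 1)
    (hsx : sx.card ≤ 5 ^ n₂) (hsy : sy.card ≤ 5 ^ n₁) :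
    patProb ρ (BadPattern U V G sx sy (max n₁ n₂ : ℕ)) ≤
      1024 / ((max n₁ n₂ : ℕ) : ℝ) ^ 10 := by
  have hN0 : 0 < max n₁ n₂ := by
    rcases Nat.eq_zero_or_pos (max n₁ n₂) with h | h
    · rw [h] at hn
      norm_num at hn
    · exact h
  have h1' : ρ ≤ 1 := h1.trans (by norm_num)
  have hcard : ((sx ×ˢ sy).card : ℝ) ≤ 25 ^ max n₁ n₂ := by
    have : (sx ×ˢ sy).card ≤ 25 ^ max n₁ n₂ := by
      rw [Finset.card_product]
      calc sx.card * sy.card ≤ 5 ^ max n₁ n₂ * 5 ^ max n₁ n₂ :=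
            Nat.mul_le_mul (hsx.trans (Nat.pow_le_pow_right (by norm_num) (le_max_right _ _)))
              (hsy.trans (Nat.pow_le_pow_right (by norm_num) (le_max_left _ _)))
        _ = _ := by rw [← mul_pow]; norm_num
    exact_mod_cast this
  set N := max n₁ n₂ with hN
  have hn0 : (0 : ℝ) < N := by exact_mod_cast hN0
  set ℓ := Real.log N with hℓ
  -- The value 44800 = 14 · 2 · 800 makes the exponent 14n: 4n pays for 25^n pairs of net points and
  -- 10n yields n⁻¹⁰.
  have ht : (Real.sqrt N / 40) ^ 2 / (2 * (1 / 44800)) = 14 * (N : ℝ) := by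
    rw [div_pow, Real.sq_sqrt hn0.le]
    ring
  have net : ((sx ×ˢ sy).card : ℝ) * Real.exp (-(14 * (N : ℝ))) ≤ 1 / (N : ℝ) ^ 10 :=
    (mul_le_mul_of_nonneg_right hcard (Real.exp_pos _).le).trans (twentyFive_pow_mul_exp_le hN0)
  have houter : ∀ q ∈ sx ×ˢ sy, ‖outer q.2 q.1‖ ≤ 1 := by
    intro q hq
    rw [norm_outer]
    exact mul_le_one₀ (hsy1 _ (Finset.mem_product.1 hq).2) (norm_nonneg _)
      (hsx1 _ (Finset.mem_product.1 hq).1)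
  have b2 : patProb ρ (fun e => ∃ q ∈ sx ×ˢ sy,
      Real.sqrt N / 40 ≤ inner ℝ (outer q.2 q.1) (patVec e)) ≤ 1 / (N : ℝ) ^ 10 := by
    refine (patProb_exists_le h0 h1' _ _ fun q hq => ?_).trans net
    rw [← ht]
    exact patProb_linear_le (by norm_num) h0 h1' hρ _ (houter q hq) (by positivity)
  have b3 : patProb ρ (fun e => ∃ q ∈ sx ×ˢ sy, G (patSupp e) ∧ Real.sqrt N / 40 ≤
      inner ℝ (resolvent U V ↑(patSupp e) (outer q.2 q.1) - outer q.2 q.1) (patVec e)) ≤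
      1 / (N : ℝ) ^ 10 := by
    refine (patProb_exists_le h0 h1' _ _ fun q hq => ?_).trans net
    rw [← ht]
    refine patProb_support_le h0 h1' (by norm_num) (by positivity) G
      (fun s => resolvent U V ↑s (outer q.2 q.1) - outer q.2 q.1) fun s hs => ?_
    have := norm_resolvent_sub_le (by norm_num) (hG s hs) (outer q.2 q.1)
    -- Here σ/(1 - σ) = 1/999 at σ = 1/1000, and its square is below 1/44800, so the same tail
    -- serves.
    have h2 : ‖resolvent U V ↑s (outer q.2 q.1) - outer q.2 q.1‖ ≤ 1 / 999 := by
      refine this.trans ?_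
      have := houter q hq
      rw [← mul_div_assoc, div_le_iff₀ (by norm_num)]
      linarith
    calc _ ≤ (1 / 999 : ℝ) ^ 2 := by gcongr
      _ ≤ _ := by norm_num
  have hres : ∀ s, G s → ∀ k, ‖resolvent U V ↑s (basisT U V k)‖ ^ 2 ≤ 8 / 10 ^ 9 / ℓ ^ 2 := by
    intro s hs k
    have h2 : ‖resolvent U V ↑s (basisT U V k)‖ ≤ 2 * ‖basisT U V k‖ := by
      refine (norm_resolvent_le (by norm_num) (hG s hs) _).trans ?_
      rw [div_le_iff₀ (by norm_num)]
      linarith [norm_nonneg (basisT U V k)]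
    calc _ ≤ (2 * ‖basisT U V k‖) ^ 2 := by gcongr
      _ = 4 * ‖basisT U V k‖ ^ 2 := by ring
      _ ≤ 4 * (2 / 10 ^ 9 / ℓ ^ 2) := by gcongr; exact hR k
      _ = _ := by ring
  have tail : (((Finset.univ : Finset (Fin n₁ × Fin n₂)).card : ℕ) : ℝ) *
      Real.exp (-((1 / 4) ^ 2 / (2 * (8 / 10 ^ 9 / ℓ ^ 2)))) ≤ 1 / (N : ℝ) ^ 10 := by
    have e1 : Real.exp (-((1 / 4) ^ 2 / (2 * (8 / 10 ^ 9 / ℓ ^ 2)))) ≤ 1 / (N : ℝ) ^ 12 := by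
      rw [← exp_neg_mul_log hn0]
      apply Real.exp_le_exp.2
      have : (1 / 4 : ℝ) ^ 2 / (2 * (8 / 10 ^ 9 / ℓ ^ 2)) = 10 ^ 9 / 256 * ℓ ^ 2 := by
        field_simp
        norm_num
      rw [this]
      nlinarith
    rw [Finset.card_univ]
    calc _ ≤ (N : ℝ) ^ 2 * (1 / (N : ℝ) ^ 12) := by
          gcongr
          exact card_index_le n₁ n₂
      _ = _ := by field_simp
  have hv : 0 < 8 / 10 ^ 9 / ℓ ^ 2 := by positivity
  have b4 := (patProb_exists_le h0 h1' (Finset.univ : Finset (Fin n₁ × Fin n₂))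
    (fun k e => G (patSupp e) ∧ 1 / 4 ≤
      inner ℝ (resolvent U V ↑(patSupp e) (basisT U V k)) (patVec e)) fun k _ =>
    patProb_support_le h0 h1' hv (by norm_num) G
      (fun s => resolvent U V ↑s (basisT U V k)) fun s hs => hres s hs k).trans tail
  have b5 := (patProb_exists_le h0 h1' (Finset.univ : Finset (Fin n₁ × Fin n₂))
    (fun k e => G (patSupp e) ∧ 1 / 4 ≤
      inner ℝ (-resolvent U V ↑(patSupp e) (basisT U V k)) (patVec e)) fun k _ =>
    patProb_support_le h0 h1' hv (by norm_num) G
      (fun s => -resolvent U V ↑s (basisT U V k)) fun s hs => by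
        rw [norm_neg]; exact hres s hs k).trans tail
  have hfin : patProb ρ (BadPattern U V G sx sy N) ≤ 1 / (N : ℝ) ^ 10 + (1 / (N : ℝ) ^ 10 +
      (1 / (N : ℝ) ^ 10 + (1 / (N : ℝ) ^ 10 + 1 / (N : ℝ) ^ 10))) := by
    refine (patProb_or_le h0 h1' _ _).trans (add_le_add hGprob ?_)
    refine (patProb_or_le h0 h1' _ _).trans (add_le_add b2 ?_)
    refine (patProb_or_le h0 h1' _ _).trans (add_le_add b3 ?_)
    exact (patProb_or_le h0 h1' _ _).trans (add_le_add b4 b5)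
  refine hfin.trans ?_
  have : 0 < 1 / (N : ℝ) ^ 10 := by positivity
  have e : (1024 : ℝ) / (N : ℝ) ^ 10 = 1024 * (1 / (N : ℝ) ^ 10) := by ring
  rw [e]
  linarith

lemma norm_basisT_sq_le_of_incoherent {μ c : ℝ} (hU : U.transpose * U = 1)
    (hV : V.transpose * V = 1) (h₁ : 0 < n₁) (h₂ : 0 < n₂) (hμ : 0 < μ) (hinc : Incoherent μ U V)
    (hlog : 0 < Real.log (max n₁ n₂ : ℕ))
    (hr : (r : ℝ) * (μ * Real.log (max n₁ n₂ : ℕ) ^ 2) ≤ c * (min n₁ n₂ : ℕ))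
    (k : Fin n₁ × Fin n₂) :
    ‖basisT U V k‖ ^ 2 ≤ 2 * c / Real.log (max n₁ n₂ : ℕ) ^ 2 := by
  have hm : (0 : ℝ) < (min n₁ n₂ : ℕ) := by exact_mod_cast lt_min h₁ h₂
  have hm1 : ((min n₁ n₂ : ℕ) : ℝ) ≤ n₁ := by exact_mod_cast min_le_left _ _
  have hm2 : ((min n₁ n₂ : ℕ) : ℝ) ≤ n₂ := by exact_mod_cast min_le_right _ _
  set m : ℝ := ((min n₁ n₂ : ℕ) : ℝ)
  set ℓ := Real.log (max n₁ n₂ : ℕ)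
  have hmr : μ * r / m ≤ c / ℓ ^ 2 := by
    rw [div_le_div_iff₀ hm (by positivity)]
    linarith
  have hμr : 0 ≤ μ * r := by positivity
  have e1 : μ * r / n₁ ≤ μ * r / m := by gcongr
  have e2 : μ * r / n₂ ≤ μ * r / m := by gcongr
  have := norm_basisT_sq_le hU hV k
  have h3 := hinc.left k.1
  have h4 := hinc.right k.2
  rw [mul_div_assoc]
  linarith

end Probability

end RobustPCA

/-! ### Choice of constants and assembly. -/

theorem mainTheorem8 :
    ∃ ρr ρs c : ℝ, 0 < ρr ∧ 0 < ρs ∧ 0 < c ∧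
      ∀ (n₁ n₂ : ℕ), 0 < n₁ → 0 < n₂ →
      ∀ (L₀ : Matrix (Fin n₁) (Fin n₂) ℝ)
        (U : Matrix (Fin n₁) (Fin L₀.rank) ℝ) (s : Fin L₀.rank → ℝ)
        (V : Matrix (Fin n₂) (Fin L₀.rank) ℝ) (μ : ℝ),
        RobustPCA.IsSVD L₀ U s V →
        0 < μ → RobustPCA.Incoherent μ U V →
        (L₀.rank : ℝ) * (μ * Real.log (max n₁ n₂ : ℕ) ^ 2) ≤ ρr * (min n₁ n₂ : ℕ) →
      ∀ (ρ : ℝ), 0 ≤ ρ → ρ ≤ ρs →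
      ∀ (X : Type*) [MeasurableSpace X] (P : Measure X) [IsProbabilityMeasure P]
        (S₀ : X → Matrix (Fin n₁) (Fin n₂) ℝ),
        RobustPCA.BernoulliRandomSigns P ρ S₀ →
      ∀ (lam : ℝ), lam = 1 / Real.sqrt (max n₁ n₂ : ℕ) →
        1 - c / ((max n₁ n₂ : ℕ) : ℝ) ^ 10 ≤
          P.real {x |
            RobustPCA.WSDefined U V (S₀ x) ∧
            RobustPCA.opNorm (RobustPCA.toMat (RobustPCA.WS lam U V (S₀ x))) < 1 / 4 ∧
            RobustPCA.maxNorm (RobustPCA.toMat (RobustPCA.projΩ (RobustPCA.supp (S₀ x))ᶜ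
              (RobustPCA.WS lam U V (S₀ x)))) < lam / 4} := by
  refine ⟨1 / 10 ^ 9, min (1 / 10 ^ 7) (1 / 44800 * Real.exp (-(2 / (1 / 44800) ^ 2))), 1024,
    by norm_num, lt_min (by norm_num) (by positivity), by norm_num, ?_⟩
  intro n₁ n₂ h₁ h₂ L₀ U s V μ hsvd hμ hinc hr ρ h0 hρ X _ P _ S₀ hS lam hlam
  -- The constant 1024 = 2^10 makes the bound vacuous here; otherwise n ≥ 3 > e and log n ≥ 1.
  by_cases hn : max n₁ n₂ ≤ 2
  · refine le_trans ?_ measureReal_nonneg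
    have hpos : (0 : ℝ) < ((max n₁ n₂ : ℕ) : ℝ) := by exact_mod_cast lt_max_of_lt_left h₁
    have hle : ((max n₁ n₂ : ℕ) : ℝ) ≤ 2 := by exact_mod_cast hn
    rw [sub_nonpos, one_le_div (by positivity)]
    calc ((max n₁ n₂ : ℕ) : ℝ) ^ 10 ≤ 2 ^ 10 := by gcongr
      _ = 1024 := by norm_num
  have h3 : (3 : ℝ) ≤ ((max n₁ n₂ : ℕ) : ℝ) := by exact_mod_cast not_le.1 hn
  have hlog : 1 ≤ Real.log (max n₁ n₂ : ℕ) := by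
    rw [Real.le_log_iff_exp_le (by linarith)]
    linarith [Real.exp_one_lt_d9]
  have hU := hsvd.orthonormal_left
  have hV := hsvd.orthonormal_right
  have hR : ∀ k, ‖RobustPCA.basisT U V k‖ ^ 2 ≤ 2 / 10 ^ 9 / Real.log (max n₁ n₂ : ℕ) ^ 2 := by
    intro k
    refine (RobustPCA.norm_basisT_sq_le_of_incoherent hU hV h₁ h₂ hμ hinc (by linarith) hr k).trans
      (le_of_eq ?_)
    ring
  have hρ7 := hρ.trans (min_le_left _ _)
  set J := ⌊12 * Real.log (max n₁ n₂ : ℕ)⌋₊ with hJ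
  -- The trace condition implies norm at most 1/1000 and is the form to which Markov's inequality
  -- applies.
  let G : Finset (Fin n₁ × Fin n₂) → Prop := fun s =>
    RobustPCA.frameMoment (RobustPCA.basisT U V) J s < ((1 / 1000 : ℝ) ^ 2) ^ (J + 1)
  have hG : ∀ s, G s →
      ‖RobustPCA.projΩ (↑s : Set (Fin n₁ × Fin n₂)) ∘L RobustPCA.projT U V‖ ≤ 1 / 1000 :=
    fun s hs => RobustPCA.norm_projΩ_comp_projT_le U V s (by norm_num)
      (RobustPCA.inner_frameOp_le_of_frameMoment_lt _ J s (by norm_num) hs)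
  have hGprob : RobustPCA.patProb ρ
      (fun e : Fin n₁ × Fin n₂ → SignType => ¬ G (RobustPCA.patSupp e)) ≤
      1 / ((max n₁ n₂ : ℕ) : ℝ) ^ 10 := by
    simp only [G, not_lt]
    exact RobustPCA.patProb_frameMoment_le h0 hρ7 hlog hR
  obtain ⟨sx, hsxc, hsx1, hsx⟩ := RobustPCA.exists_half_net (EuclideanSpace ℝ (Fin n₂))
  obtain ⟨sy, hsyc, hsy1, hsy⟩ := RobustPCA.exists_half_net (EuclideanSpace ℝ (Fin n₁))
  rw [finrank_euclideanSpace_fin] at hsxc hsyc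
  have hbad := RobustPCA.patProb_badPattern_le h0 hρ7 (hρ.trans (min_le_right _ _)) hlog hR hG
    hGprob sx sy hsx1 hsy1 hsxc hsyc
  refine le_trans (by linarith) (hS.one_sub_patProb_le
    (RobustPCA.BadPattern U V G sx sy (max n₁ n₂ : ℕ)) _ fun x hx => ?_)
  exact RobustPCA.certificate_of_not_badPattern hU hV (S₀ x) (by norm_num) (by linarith) hlam hG
    sx sy hsx hsy hx
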